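/- Work over $\mathbb{Q}$ and let $n\ge 2$. For $m\ge 0$ let $\mathcal{B}_m=S_m\ltimes\mathbb{Z}_2^m$ be the group of signed permutations $w=w_1\ldots w_m$ (barred symbols are ordered as negative integers), put $w_0=0$, and let $\mathrm{Des}(w)=\{i\in\{0,\ldots,m-1\}: w_i>w_{i+1}\}$. For $J\subseteq\{0,\ldots,m-1\}$ put $Y_J=\sum_{\mathrm{Des}(w)=J}w$ and $X_J=\sum_{\mathrm{Des}(w)\subseteq J}w$ in $\mathbb{Q}\mathcal{B}_m$. The descent algebra $\Sigma(B_m)$ is the span of the $Y_J$; the $X_J$ form a basis of it. For $m\ge 1$ let $\beta:\Sigma(B_m)\to\Sigma(B_{m-1})$ be the linear map with $\beta(X_J)=X_{J-1}$ if $0\notin J$ and $\beta(X_J)=0$ if $0\in J$. Let $\beta^2:\Sigma(B_n)\to\Sigma(B_{n-2})$ be the composite of two such maps, and $I_n^{0,1}=\ker(\beta^2)$. For $w\in S_m$ (with $w_0=0$) let $\mathrm{Peak}(w)=\{i\in\{1,\ldots,m-1\}: w_{i-1}<w_i>w_{i+1}\}$ and let $\overset{\circ}{\mathrm{Peak}}(w)=\mathrm{Peak}(w)\setminus\{1\}$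 be the set of interior peaks. Let $\mathcal{F}_m$ be the set of all $F\subseteq\{1,\ldots,m-1\}$ that contain no two consecutive integers. Let $\mathfrak{P}_m\subseteq\mathbb{Q}S_m$ be the span of the linearly independent elements $P_F=\sum_{\mathrm{Peak}(w)=F}w$, $F\in\mathcal{F}_m$ (the peak algebra), and $\overset{\circ}{\mathfrak{P}}_m\subseteq\mathfrak{P}_m$ the span of the elements $\overset{\circ}{P}_F=\sum_{\overset{\circ}{\mathrm{Peak}}(w)=F}w$, $F\in\mathcal{F}_m$, $1\notin F$ (the peak ideal). Let $\pi:\mathfrak{P}_n\to\mathfrak{P}_{n-2}$ be the linear map with $\pi(P_F)=P_{F-2}$ if $1,2\notin F$, $\pi(P_F)=-P_{(F\setminus\{1\})-2}$ if $1\in F$, and $\pi(P_F)=0$ if $2\in F$. Let $\varphi:\mathbb{Q}\mathcal{B}_m\to\mathbb{Q}S_m$ be the linear extension of the map $\mathcal{B}_m\to S_m$ that forgets the signs. Then $\Sigma(B_n),\Sigma(B_{n-2}),\mathfrak{P}_n,\mathfrak{P}_{n-2}$ are unital subalgebras of the respective group algebras, $I_n^{0,1}$ and $\overset{\circ}{\mathfrak{P}}_n$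 are two-sided ideals of $\Sigma(B_n)$ and $\mathfrak{P}_n$ respectively, $\beta^2$ and $\pi$ are morphisms of unital algebras, $\varphi$ restricts to maps $I_n^{0,1}\to\overset{\circ}{\mathfrak{P}}_n$, $\Sigma(B_n)\to\mathfrak{P}_n$ and $\Sigma(B_{n-2})\to\mathfrak{P}_{n-2}$, the last two being morphisms of unital algebras, and the diagram $$\begin{array}{ccccccccc} 0&\to& I_n^{0,1}&\hookrightarrow&\Sigma(B_n)&\xrightarrow{\ \beta^2\ }&\Sigma(B_{n-2})&\to&0\\ &&\downarrow{\scriptstyle\varphi}&&\downarrow{\scriptstyle\varphi}&&\downarrow{\scriptstyle\varphi}&&\\ 0&\to&\overset{\circ}{\mathfrak{P}}_n&\hookrightarrow&\mathfrak{P}_n&\xrightarrow{\ \pi\ }&\mathfrak{P}_{n-2}&\to&0 \end{array}$$ is commutative, its rows are exact, and its vertical maps are surjective. -/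

import Mathlib

open Finset

noncomputable section

namespace PeakB

/-! ### Class sums in a group algebra -/

section Generic

variable {G α : Type*} [Group G] [Fintype G] [DecidableEq α]

/-- The sum in `ℚ G` of all `w` with `d w = a`. -/
def classSum (d : G → α) (a : α) : MonoidAlgebra ℚ G :=
  ∑ w ∈ (univ : Finset G).filter (fun w => d w = a), MonoidAlgebra.of ℚ G w

/-- The linear span of the elements `classSum d a`, for `a` in the finite set `s`. -/
def classSpan (d : G → α) (s : Finset α) : Submodule ℚ (MonoidAlgebra ℚ G) :=
  Submodule.span ℚ (Set.range fun a : s => classSum d (a : α))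

theorem coeff_classSum (d : G → α) (a : α) (w : G) :
    (classSum d a).coeff w = if d w = a then 1 else 0 := by
  classical
  simp only [classSum, MonoidAlgebra.of_apply, MonoidAlgebra.coeff_sum, Finsupp.finsetSum_apply,
    MonoidAlgebra.coeff_single, Finsupp.single_apply]
  simp [Finset.sum_ite_eq']

theorem classSum_eq_zero (d : G → α) (a : α) (h : ∀ w, d w ≠ a) : classSum d a = 0 := by
  simp [classSum, Finset.filter_eq_empty_iff.2 fun w _ => h w]

theorem classSum_mem (d : G → α) (s : Finset α) (hd : ∀ w, d w ∈ s) (a : α) :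
    classSum d a ∈ classSpan d s := by
  by_cases ha : a ∈ s
  · exact Submodule.subset_span ⟨⟨a, ha⟩, rfl⟩
  · rw [classSum_eq_zero d a fun w h => ha (h ▸ hd w)]
    exact Submodule.zero_mem _

theorem linearIndependent_classSum (d : G → α) (s : Finset α) (h : ∀ a ∈ s, ∃ w, d w = a) :
    LinearIndependent ℚ (fun a : s => classSum d (a : α)) := by
  classical
  rw [Fintype.linearIndependent_iff]
  intro g hg a
  obtain ⟨w, hw⟩ := h a a.2
  have := congrArg (fun x => x.coeff w) hg
  simp only [MonoidAlgebra.coeff_sum, Finsupp.finsetSum_apply, MonoidAlgebra.coeff_smul,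
    Finsupp.smul_apply, coeff_classSum, hw] at this
  rw [Finset.sum_eq_single a] at this
  · simpa using this
  · intro b _ hb
    rw [if_neg fun h => hb (Subtype.ext h.symm)]
    simp
  · simp

/-- The basis of `classSpan d s` formed by the class sums. -/
def classBasis (d : G → α) (s : Finset α) (h : ∀ a ∈ s, ∃ w, d w = a) :
    Module.Basis s ℚ (classSpan d s) :=
  Module.Basis.span (linearIndependent_classSum d s h)

end Generic

/-! ### Signed permutations and the descent algebra of type B -/

/-- The group `ℬ_n = S_n ⋉ ℤ₂ⁿ` of signed permutations. The element with components `ε = w.left`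
and `σ = w.right` is the signed permutation `i ↦ ε (σ i) · σ i`, `-i ↦ -(ε (σ i) · σ i)`, and the
product is composition of these maps of `{±1, …, ±n}`. -/
abbrev SignedPerm (n : ℕ) : Type :=
  (Fin n → ℤˣ) ⋊[(mulAutArrow : Equiv.Perm (Fin n) →* MulAut (Fin n → ℤˣ))] Equiv.Perm (Fin n)

instance (n : ℕ) : Fintype (SignedPerm n) := Fintype.ofEquiv _ SemidirectProduct.equivProd.symm

/-- The entries `w_0 = 0` and `w_1, …, w_n` of `w = w_1 … w_n`; a barred symbol is a negative
integer. -/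
def entryB {n : ℕ} (w : SignedPerm n) : ℕ → ℤ
  | 0 => 0
  | i + 1 => if h : i < n then (w.left (w.right ⟨i, h⟩) : ℤ) * ((w.right ⟨i, h⟩ : ℕ) + 1) else 0

/-- The descent set, a subset of `{0, 1, …, n-1}`. -/
def desB {n : ℕ} (w : SignedPerm n) : Finset ℕ :=
  (range n).filter fun i => entryB w (i + 1) < entryB w i

/-- `Y_J`, the sum of all signed permutations with descent set `J`. -/
def Y (n : ℕ) (J : Finset ℕ) : MonoidAlgebra ℚ (SignedPerm n) := classSum desB J

/-- `X_J`, the sum of all signed permutations with descent set contained in `J`. -/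
def X (n : ℕ) (J : Finset ℕ) : MonoidAlgebra ℚ (SignedPerm n) :=
  ∑ w ∈ (univ : Finset (SignedPerm n)).filter (fun w => desB w ⊆ J), MonoidAlgebra.of ℚ _ w

/-- The descent algebra `Σ(B_n)`, the span of the `Y_J` with `J ⊆ {0, 1, …, n-1}`. -/
def descentB (n : ℕ) : Submodule ℚ (MonoidAlgebra ℚ (SignedPerm n)) :=
  classSpan desB (range n).powerset

theorem desB_mem {n : ℕ} (w : SignedPerm n) : desB w ∈ (range n).powerset :=
  mem_powerset.2 (filter_subset _ _)

theorem exists_desB {n : ℕ} {J : Finset ℕ} (hJ : J ∈ (range n).powerset) :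
    ∃ w : SignedPerm n, desB w = J := by
  classical
  refine ⟨⟨fun i => if (i : ℕ) ∈ J then -1 else 1, 1⟩, ?_⟩
  ext i
  simp only [desB, mem_filter, mem_range]
  have hJ' := mem_powerset.1 hJ
  constructor
  · rintro ⟨hi, h⟩
    by_contra hc
    rcases i with _ | i
    · simp [entryB, hi, hc] at h
    · have hi' : i < n := by omega
      simp only [entryB, hi, hi', dif_pos, Equiv.Perm.one_apply, hc, if_false] at h
      by_cases hj : i ∈ J <;> (simp [hj] at h; try omega)
  · intro hi
    have hn : i < n := mem_range.1 (hJ' hi)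
    refine ⟨hn, ?_⟩
    rcases i with _ | i
    · simp [entryB, hn, hi]
    · have hi' : i < n := by omega
      simp only [entryB, hn, hi', dif_pos, Equiv.Perm.one_apply, hi, if_true]
      by_cases hj : i ∈ J <;> simp [hj] <;> omega

theorem X_eq_sum (n : ℕ) (J : Finset ℕ) :
    X n J = ∑ I ∈ (range n).powerset.filter (fun I => I ⊆ J), Y n I := by
  classical
  unfold X Y classSum
  rw [← Finset.sum_fiberwise_of_maps_to (s := univ.filter fun w : SignedPerm n => desB w ⊆ J)
    (t := (range n).powerset.filter (fun I => I ⊆ J)) (g := desB)]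
  · refine Finset.sum_congr rfl fun I hI => Finset.sum_congr ?_ fun _ _ => rfl
    ext w
    simp only [mem_filter, mem_univ, true_and, and_iff_right_iff_imp]
    rintro rfl
    exact (mem_filter.1 hI).2
  · intro w hw
    exact mem_filter.2 ⟨desB_mem w, (mem_filter.1 hw).2⟩

theorem X_mem (n : ℕ) (J : Finset ℕ) : X n J ∈ descentB n := by
  rw [X_eq_sum]
  exact Submodule.sum_mem _ fun I _ => classSum_mem _ _ desB_mem I

/-- `X_J` as an element of `Σ(B_n)`. -/
def xElem (n : ℕ) (J : Finset ℕ) : descentB n := ⟨X n J, X_mem n J⟩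

theorem span_xElem (n : ℕ) :
    ⊤ ≤ Submodule.span ℚ (Set.range fun J : ((range n).powerset : Finset (Finset ℕ)) =>
      xElem n (J : Finset ℕ)) := by
  classical
  set T := Submodule.span ℚ (Set.range fun J : ((range n).powerset : Finset (Finset ℕ)) =>
      xElem n (J : Finset ℕ)) with hT
  have key : ∀ J : Finset ℕ, J ⊆ range n → Y n J ∈ T.map (descentB n).subtype := by
    intro J
    induction J using Finset.strongInduction with
    | H J ih =>
      intro hJ
      have hX : X n J ∈ T.map (descentB n).subtype :=
        ⟨xElem n J, Submodule.subset_span ⟨⟨J, mem_powerset.2 hJ⟩, rfl⟩, rfl⟩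
      have hmem : J ∈ (range n).powerset.filter (fun I => I ⊆ J) :=
        mem_filter.2 ⟨mem_powerset.2 hJ, Subset.refl _⟩
      have h := X_eq_sum n J
      rw [← Finset.add_sum_erase _ _ hmem] at h
      rw [← sub_eq_iff_eq_add] at h
      rw [← h]
      refine Submodule.sub_mem _ hX (Submodule.sum_mem _ fun I hI => ?_)
      obtain ⟨hne, hI⟩ := mem_erase.1 hI
      obtain ⟨hIn, hIJ⟩ := mem_filter.1 hI
      exact ih I (hIJ.ssubset_of_ne hne) (mem_powerset.1 hIn)
  have hle : descentB n ≤ T.map (descentB n).subtype := by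
    unfold descentB classSpan
    rw [Submodule.span_le]
    rintro _ ⟨J, rfl⟩
    exact key _ (mem_powerset.1 J.2)
  intro x _
  obtain ⟨y, hy, hyx⟩ := hle x.2
  rwa [← Subtype.ext hyx]

/-- The basis `{X_J}` of `Σ(B_n)`, indexed by the subsets `J` of `{0, 1, …, n-1}`. -/
def basisX (n : ℕ) : Module.Basis ((range n).powerset : Finset (Finset ℕ)) ℚ (descentB n) :=
  basisOfTopLeSpanOfCardEqFinrank (fun J => xElem n (J : Finset ℕ)) (span_xElem n)
    (Module.finrank_eq_card_basis
      (classBasis desB (range n).powerset fun _ h => exists_desB h)).symm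

theorem basisX_apply (n : ℕ) (J : ((range n).powerset : Finset (Finset ℕ))) :
    basisX n J = xElem n (J : Finset ℕ) :=
  congrFun (coe_basisOfTopLeSpanOfCardEqFinrank (fun J : ((range n).powerset : Finset (Finset ℕ)) =>
    xElem n (J : Finset ℕ)) (span_xElem n) _) J

/-- `β : Σ(B_{n+1}) → Σ(B_n)`, the linear map with `X_J ↦ X_{J-1}` if `0 ∉ J`, and `X_J ↦ 0` if
`0 ∈ J`. -/
def beta (n : ℕ) : descentB (n + 1) →ₗ[ℚ] descentB n :=
  (basisX (n + 1)).constr ℚ fun J =>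
    if 0 ∈ (J : Finset ℕ) then 0 else xElem n ((J : Finset ℕ).image (· - 1))

theorem beta_xElem (n : ℕ) {J : Finset ℕ} (hJ : J ⊆ range (n + 1)) :
    beta n (xElem (n + 1) J) = if 0 ∈ J then 0 else xElem n (J.image (· - 1)) := by
  have h := (basisX (n + 1)).constr_basis ℚ (fun J =>
    if 0 ∈ (J : Finset ℕ) then 0 else xElem n ((J : Finset ℕ).image (· - 1)))
    ⟨J, mem_powerset.2 hJ⟩
  rw [basisX_apply] at h
  exact h

/-- `β² : Σ(B_{n+2}) → Σ(B_n)`. -/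
def betaSq (n : ℕ) : descentB (n + 2) →ₗ[ℚ] descentB n := beta n ∘ₗ beta (n + 1)

/-- `I^{0,1}_{n+2}`, the kernel of `β²`, as a subspace of the group algebra of `ℬ_{n+2}`. -/
def idealB (n : ℕ) : Submodule ℚ (MonoidAlgebra ℚ (SignedPerm (n + 2))) :=
  (LinearMap.ker (betaSq n)).map (descentB (n + 2)).subtype

theorem idealB_le (n : ℕ) : idealB n ≤ descentB (n + 2) := Submodule.map_subtype_le _ _

/-! ### Peaks, the peak algebra and the peak ideal -/

/-- The entries `w_0 = 0` and `w_1, …, w_n` of `w = w_1 … w_n`. -/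
def entryA {n : ℕ} (w : Equiv.Perm (Fin n)) : ℕ → ℕ
  | 0 => 0
  | i + 1 => if h : i < n then (w ⟨i, h⟩ : ℕ) + 1 else 0

/-- The set of peaks of `w`, a subset of `{1, …, n-1}`. -/
def peak {n : ℕ} (w : Equiv.Perm (Fin n)) : Finset ℕ :=
  (Icc 1 (n - 1)).filter fun i => entryA w (i - 1) < entryA w i ∧ entryA w (i + 1) < entryA w i

/-- The set of interior peaks of `w`, a subset of `{2, …, n-1}`. -/
def intPeak {n : ℕ} (w : Equiv.Perm (Fin n)) : Finset ℕ :=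
  (Icc 2 (n - 1)).filter fun i => entryA w (i - 1) < entryA w i ∧ entryA w (i + 1) < entryA w i

/-- `𝓕_n`: the subsets of `{1, …, n-1}` that do not contain two consecutive integers. -/
def fibSets (n : ℕ) : Finset (Finset ℕ) :=
  (Icc 1 (n - 1)).powerset.filter fun F => ∀ i ∈ F, i + 1 ∉ F

/-- The sets in `𝓕_n` that do not contain `1`. -/
def intFibSets (n : ℕ) : Finset (Finset ℕ) := (fibSets n).filter fun F => 1 ∉ F

/-- The peak algebra, the span of the sums `P_F` of all permutations with peak set `F`, for `F`
in `𝓕_n`. -/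
def peakAlg (n : ℕ) : Submodule ℚ (MonoidAlgebra ℚ (Equiv.Perm (Fin n))) :=
  classSpan peak (fibSets n)

/-- The peak ideal, the span of the sums of all permutations with interior peak set `F`, for `F`
in `𝓕_n` with `1 ∉ F`. -/
def peakIdeal (n : ℕ) : Submodule ℚ (MonoidAlgebra ℚ (Equiv.Perm (Fin n))) :=
  classSpan intPeak (intFibSets n)

theorem peak_mem {n : ℕ} (w : Equiv.Perm (Fin n)) : peak w ∈ fibSets n := by
  refine mem_filter.2 ⟨mem_powerset.2 (filter_subset _ _), fun i hi hi' => ?_⟩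
  have h1 := (mem_filter.1 hi).2.2
  have h2 := (mem_filter.1 hi').2.1
  rw [Nat.add_sub_cancel] at h2
  omega

theorem intPeak_eq {n : ℕ} (w : Equiv.Perm (Fin n)) : intPeak w = (peak w).erase 1 := by
  ext i
  simp only [intPeak, peak, mem_filter, mem_erase, mem_Icc]
  constructor
  · rintro ⟨⟨h1, h2⟩, h⟩
    exact ⟨by omega, ⟨by omega, h2⟩, h⟩
  · rintro ⟨h0, ⟨h1, h2⟩, h⟩
    exact ⟨⟨by omega, h2⟩, h⟩

theorem peakIdeal_le (n : ℕ) : peakIdeal n ≤ peakAlg n := by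
  classical
  unfold peakIdeal classSpan
  rw [Submodule.span_le]
  rintro _ ⟨F, rfl⟩
  have h : classSum (intPeak (n := n)) (F : Finset ℕ) =
      ∑ E ∈ (fibSets n).filter (fun E => E.erase 1 = (F : Finset ℕ)), classSum (peak (n := n)) E := by
    unfold classSum
    rw [← Finset.sum_fiberwise_of_maps_to
      (s := univ.filter fun w : Equiv.Perm (Fin n) => intPeak w = F)
      (t := (fibSets n).filter (fun E => E.erase 1 = (F : Finset ℕ))) (g := peak)]
    · refine Finset.sum_congr rfl fun E hE => Finset.sum_congr ?_ fun _ _ => rfl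
      ext w
      simp only [mem_filter, mem_univ, true_and, and_iff_right_iff_imp]
      rintro rfl
      rw [intPeak_eq]
      exact (mem_filter.1 hE).2
    · intro w hw
      refine mem_filter.2 ⟨peak_mem w, ?_⟩
      rw [← intPeak_eq]
      exact (mem_filter.1 hw).2
  simp only [SetLike.mem_coe]
  rw [h]
  exact Submodule.sum_mem _ fun E _ => classSum_mem _ _ peak_mem E

/-- Exchange `i` and `i + 1` for every `i ∈ F`. -/
def swapFun (F : Finset ℕ) (i : ℕ) : ℕ :=
  if i ∈ F then i + 1 else if 1 ≤ i ∧ i - 1 ∈ F then i - 1 else i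

theorem exists_peak {n : ℕ} {F : Finset ℕ} (hF : F ∈ fibSets n) :
    ∃ w : Equiv.Perm (Fin n), peak w = F := by
  classical
  obtain ⟨hF1, hF2⟩ := mem_filter.1 hF
  have hF1 : ∀ i ∈ F, 1 ≤ i ∧ i ≤ n - 1 := fun i hi => mem_Icc.1 (mem_powerset.1 hF1 hi)
  have hlt : ∀ i, 1 ≤ i → i ≤ n → 1 ≤ swapFun F i ∧ swapFun F i ≤ n := by
    intro i h1 h2
    unfold swapFun
    split_ifs with h h'
    · have := hF1 i h; omega
    · have := hF1 _ h'.2; omega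
    · omega
  have hinv : ∀ i, swapFun F (swapFun F i) = i := by
    intro i
    by_cases h : i ∈ F
    · have h1 : swapFun F i = i + 1 := by simp [swapFun, h]
      rw [h1]
      simp [swapFun, h, hF2 i h]
    · by_cases h' : 1 ≤ i ∧ i - 1 ∈ F
      · have h1 : swapFun F i = i - 1 := by simp only [swapFun, if_neg h, if_pos h']
        rw [h1, swapFun, if_pos h'.2]
        omega
      · have h1 : swapFun F i = i := by simp only [swapFun, if_neg h, if_neg h']
        rw [h1, h1]
  let f : Fin n → Fin n := fun i => ⟨swapFun F (i + 1) - 1, by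
    have := hlt (i + 1) (by omega) (by omega); omega⟩
  have hf : Function.Involutive f := by
    intro i
    apply Fin.ext
    have := hlt (i + 1) (by omega) (by omega)
    simp only [f]
    rw [Nat.sub_add_cancel this.1, hinv]
    omega
  have hentry : ∀ i, i ≤ n → entryA hf.toPerm i = swapFun F i := by
    intro i hi
    rcases i with _ | i
    · have h0 : 0 ∉ F := fun h => by have := hF1 0 h; omega
      simp [entryA, swapFun, h0]
    · have := hlt (i + 1) (by omega) hi
      simp only [entryA, dif_pos (show i < n by omega), Function.Involutive.coe_toPerm, f]
      omega
  refine ⟨hf.toPerm, ?_⟩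
  ext i
  simp only [peak, mem_filter, mem_Icc]
  constructor
  · rintro ⟨⟨h1, h2⟩, h3, h4⟩
    rw [hentry _ (by omega), hentry _ (by omega)] at h3 h4
    by_contra hc
    have e1 : swapFun F i ≤ i := by
      simp only [swapFun, if_neg hc]; split_ifs <;> omega
    have e2 : i + 1 ≤ swapFun F (i + 1) := by
      simp only [swapFun, Nat.add_sub_cancel, hc, and_false, if_false]; split_ifs <;> omega
    omega
  · intro hi
    have hb := hF1 i hi
    refine ⟨hb, ?_⟩
    rw [hentry _ (by omega), hentry _ (by omega), hentry _ (by omega)]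
    have e0 : i - 1 ∉ F := fun h => hF2 _ h (by rwa [Nat.sub_add_cancel hb.1])
    have e1 : swapFun F i = i + 1 := by simp [swapFun, hi]
    have e2 : swapFun F (i + 1) = i := by simp [swapFun, hi, hF2 i hi]
    have e3 : swapFun F (i - 1) ≤ i - 1 := by
      simp only [swapFun, if_neg e0]; split_ifs <;> omega
    omega

/-- The basis `{P_F}` of the peak algebra, indexed by `𝓕_n`. -/
def basisP (n : ℕ) : Module.Basis (fibSets n) ℚ (peakAlg n) :=
  classBasis peak (fibSets n) fun _ h => exists_peak h

/-- `P_F` as an element of the peak algebra. -/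
def pElem (n : ℕ) (F : Finset ℕ) : peakAlg n := ⟨classSum peak F, classSum_mem _ _ peak_mem F⟩

/-- `π : P_{n+2} → P_n`, the linear map with `P_F ↦ -P_{(F∖{1})-2}` if `1 ∈ F`, `P_F ↦ 0` if
`2 ∈ F`, and `P_F ↦ P_{F-2}` if neither `1` nor `2` belongs to `F`. -/
def piMap (n : ℕ) : peakAlg (n + 2) →ₗ[ℚ] peakAlg n :=
  (basisP (n + 2)).constr ℚ fun F =>
    if 1 ∈ (F : Finset ℕ) then -pElem n (((F : Finset ℕ).erase 1).image (· - 2))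
    else if 2 ∈ (F : Finset ℕ) then 0
    else pElem n ((F : Finset ℕ).image (· - 2))

theorem piMap_pElem (n : ℕ) {F : Finset ℕ} (hF : F ∈ fibSets (n + 2)) :
    piMap n (pElem (n + 2) F) =
      if 1 ∈ F then -pElem n ((F.erase 1).image (· - 2))
      else if 2 ∈ F then 0 else pElem n (F.image (· - 2)) := by
  have h := (basisP (n + 2)).constr_basis ℚ (fun F =>
    if 1 ∈ (F : Finset ℕ) then -pElem n (((F : Finset ℕ).erase 1).image (· - 2))
    else if 2 ∈ (F : Finset ℕ) then 0
    else pElem n ((F : Finset ℕ).image (· - 2))) ⟨F, hF⟩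
  have e : basisP (n + 2) ⟨F, hF⟩ = pElem (n + 2) F :=
    Subtype.ext (congrArg Subtype.val (Module.Basis.span_apply
      (linearIndependent_classSum peak (fibSets (n + 2)) fun _ h => exists_peak h) ⟨F, hF⟩))
  rw [e] at h
  exact h

/-! ### Forgetting the signs, algebras and ideals -/

/-- The algebra morphism `φ : ℚℬ_n → ℚS_n` that forgets the signs. -/
def phi (n : ℕ) :
    MonoidAlgebra ℚ (SignedPerm n) →ₐ[ℚ] MonoidAlgebra ℚ (Equiv.Perm (Fin n)) :=
  MonoidAlgebra.mapDomainAlgHom ℚ ℚ SemidirectProduct.rightHom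

section Algebras

variable {A B : Type*} [Ring A] [Algebra ℚ A] [Ring B] [Algebra ℚ B]

/-- The subspace `S` is a unital subalgebra. -/
structure IsSubalgebra (S : Submodule ℚ A) : Prop where
  one_mem : (1 : A) ∈ S
  mul_mem : ∀ x ∈ S, ∀ y ∈ S, x * y ∈ S

/-- `I` is a two-sided ideal of the subalgebra `S`. -/
structure IsIdealOf (I S : Submodule ℚ A) : Prop where
  le : I ≤ S
  mul_mem_left : ∀ a ∈ S, ∀ x ∈ I, a * x ∈ I
  mul_mem_right : ∀ x ∈ I, ∀ a ∈ S, x * a ∈ I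

/-- `S` and `T` are unital subalgebras, and the linear map `f` preserves the unit and products. -/
structure IsAlgMorphism {S : Submodule ℚ A} {T : Submodule ℚ B} (f : S →ₗ[ℚ] T) : Prop where
  source : IsSubalgebra S
  target : IsSubalgebra T
  map_one : (f ⟨1, source.one_mem⟩ : B) = 1
  map_mul : ∀ x y : S, (f ⟨x * y, source.mul_mem _ x.2 _ y.2⟩ : B) = f x * f y

end Algebras

end PeakB

end

noncomputable section

namespace PeakB

/-! ### Sign vectors of the type B arrangement -/

section SignVectors

variable {n : ℕ}

/-! The descent algebra is studied through the faces of the type B arrangement. A face is the sign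
vector of a function `f` on `{1, …, n}`: it records the signs of all differences between the values
`0, ±f 1, …, ±f n`, and in a product `F G` the face `G` breaks the ties of `F`. Orbits of faces
under signed permutations are indexed by the sets `J ⊆ {0, …, n-1}`, and the orbit sums span an
algebra, `faceInv`. Let `C₀` be the fundamental chamber. Sending `F` to the `w` with `F C₀ = w C₀`
maps the orbit sum of `J` to `X_J` and reverses products on `faceInv` (`faceToPerm_orbitSum`,
`faceToPerm_mul`), so `Σ(B_n)` is an algebra. Dropping the first coordinate of a face where it
vanishes, and killing the face otherwise, is multiplicative and induces `β` (`beta_faceToPerm`);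
hence `β` is a morphism.

The peak side is reached through `φ`. For a fixed permutation, prescribing the descent set `J` of
its signed versions constrains each sign separately. Counting the solutions gives `φ(Y_J) = ∑ 2^|F|
P_F` over the `F ⊆ D` in `𝓕_n`, where `D` is the set of positions at which membership in `J` changes
(`phi_Y`). This is triangular for inclusion, so `φ` maps `Σ(B_n)` onto the peak algebra, which is
therefore an algebra.

On the `Y_J` the map `β` is a shift up to sign (`beta_yElem`), and the coefficient of `P_G` in
`π(x)` is the coefficient of `G+2` minus that of `{1} ∪ (G+2)` in `x` (`piMap_peakSum`). The right
square then comes down to `2^k - 2^(k+1) = -2^k`, and `π` inherits surjectivity and multiplicativity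
from `β²`. The kernel of `π` consists of the elements whose coefficients do not see whether `1` is a
peak, which is the peak ideal. Finally `φ` is onto between the kernels because `Y_J + Y_{J ∪ {0}}`
lies in the kernel of `β`, and its images are triangular in the interior peak sums
(`phi_yElem_add`). -/

/-- The points `0, ±1, …, ±n` on which signed permutations act. -/
abbrev Pt (n : ℕ) : Type := Option (Fin n × ℤˣ)

/-- The odd extension of a function on `{1, …, n}` to `{0, ±1, …, ±n}`. -/
def oddExt (f : Fin n → ℤ) : Pt n → ℤ
  | none => 0
  | some (i, s) => s * f i

/-- The action of signed permutations on points. -/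
def actPt (w : SignedPerm n) : Pt n → Pt n
  | none => none
  | some (i, s) => some (w.right i, w.left (w.right i) * s)

/-- The action of signed permutations on functions. -/
def act (w : SignedPerm n) (f : Fin n → ℤ) (j : Fin n) : ℤ :=
  w.left j * f (w.right⁻¹ j)

theorem left_mul_apply (v w : SignedPerm n) (j : Fin n) :
    (v * w).left j = v.left j * w.left (v.right⁻¹ j) := by
  rw [SemidirectProduct.mul_left]
  rfl

theorem actPt_one (a : Pt n) : actPt (1 : SignedPerm n) a = a := by
  rcases a with _ | ⟨i, s⟩ <;> simp [actPt]

theorem actPt_mul (v w : SignedPerm n) (a : Pt n) : actPt (v * w) a = actPt v (actPt w a) := by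
  rcases a with _ | ⟨i, s⟩
  · rfl
  · simp [actPt, left_mul_apply, mul_assoc, SemidirectProduct.mul_right]

theorem act_mul (v w : SignedPerm n) (f : Fin n → ℤ) : act (v * w) f = act v (act w f) := by
  ext j
  simp [act, left_mul_apply, mul_assoc, SemidirectProduct.mul_right, mul_inv_rev]

theorem act_apply_right (w : SignedPerm n) (f : Fin n → ℤ) (i : Fin n) :
    act w f (w.right i) = w.left (w.right i) * f i := by
  simp [act]

theorem units_int_mul_self (s : ℤˣ) : (s : ℤ) * s = 1 := by
  rcases Int.units_eq_one_or s with h | h <;> simp [h]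

theorem oddExt_act (w : SignedPerm n) (f : Fin n → ℤ) (a : Pt n) :
    oddExt (act w f) (actPt w a) = oddExt f a := by
  rcases a with _ | ⟨i, s⟩
  · rfl
  · simp only [oddExt, actPt, act_apply_right, Units.val_mul]
    linear_combination (s * f i : ℤ) * units_int_mul_self (w.left (w.right i))

/-- Sign vectors, indexed by the pairs of points. -/
@[ext]
structure SignVec (n : ℕ) where
  toFun : Pt n → Pt n → SignType

instance : Finite (SignVec n) :=
  Finite.of_injective SignVec.toFun fun _ _ h => SignVec.ext h

instance : Fintype (SignVec n) := Fintype.ofFinite _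

instance : DecidableEq (SignVec n) := Classical.decEq _

/-- The product of sign vectors: the second factor is used where the first one vanishes. -/
instance : Monoid (SignVec n) where
  one := ⟨fun _ _ => 0⟩
  mul F G := ⟨fun a b => if F.toFun a b = 0 then G.toFun a b else F.toFun a b⟩
  one_mul F := by
    ext a b
    change (if (0 : SignType) = 0 then F.toFun a b else 0) = F.toFun a b
    exact if_pos rfl
  mul_one F := by
    ext a b
    change (if F.toFun a b = 0 then 0 else F.toFun a b) = F.toFun a b
    split_ifs with h <;> simp [h]
  mul_assoc F G H := by
    ext a b
    change (if (if F.toFun a b = 0 then G.toFun a b else F.toFun a b) = 0 then H.toFun a b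
      else (if F.toFun a b = 0 then G.toFun a b else F.toFun a b)) =
      (if F.toFun a b = 0 then (if G.toFun a b = 0 then H.toFun a b else G.toFun a b)
        else F.toFun a b)
    by_cases h : F.toFun a b = 0 <;> simp [h]

theorem SignVec.one_toFun (a b : Pt n) : (1 : SignVec n).toFun a b = 0 := rfl

theorem SignVec.mul_toFun (F G : SignVec n) (a b : Pt n) :
    (F * G).toFun a b = if F.toFun a b = 0 then G.toFun a b else F.toFun a b := rfl

instance : MulAction (SignedPerm n) (SignVec n) where
  smul w F := ⟨fun a b => F.toFun (actPt w⁻¹ a) (actPt w⁻¹ b)⟩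
  one_smul F := by
    ext a b
    change F.toFun (actPt 1⁻¹ a) (actPt 1⁻¹ b) = _
    rw [inv_one, actPt_one, actPt_one]
  mul_smul v w F := by
    ext a b
    change F.toFun (actPt (v * w)⁻¹ a) (actPt (v * w)⁻¹ b) =
      F.toFun (actPt w⁻¹ (actPt v⁻¹ a)) (actPt w⁻¹ (actPt v⁻¹ b))
    rw [mul_inv_rev, actPt_mul, actPt_mul]

theorem SignVec.smul_toFun (w : SignedPerm n) (F : SignVec n) (a b : Pt n) :
    (w • F).toFun a b = F.toFun (actPt w⁻¹ a) (actPt w⁻¹ b) := rfl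

theorem SignVec.smul_mul (w : SignedPerm n) (F G : SignVec n) :
    w • (F * G) = (w • F) * (w • G) := rfl

theorem SignVec.smul_one (w : SignedPerm n) : w • (1 : SignVec n) = 1 := rfl

/-- The sign vector of a function. -/
def sgn (f : Fin n → ℤ) : SignVec n := ⟨fun a b => SignType.sign (oddExt f b - oddExt f a)⟩

theorem sgn_toFun (f : Fin n → ℤ) (a b : Pt n) :
    (sgn f).toFun a b = SignType.sign (oddExt f b - oddExt f a) := rfl

theorem smul_sgn (w : SignedPerm n) (f : Fin n → ℤ) : w • sgn f = sgn (act w f) := by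
  ext a b
  rw [SignVec.smul_toFun, sgn_toFun, sgn_toFun, ← oddExt_act w f (actPt w⁻¹ a), ← oddExt_act w f (actPt w⁻¹ b),
    ← actPt_mul, ← actPt_mul, mul_inv_cancel, actPt_one, actPt_one]

theorem sgn_zero : sgn (0 : Fin n → ℤ) = 1 := by
  ext a b
  rw [sgn_toFun, SignVec.one_toFun]
  rcases a with _ | ⟨i, s⟩ <;> rcases b with _ | ⟨j, t⟩ <;> simp [oddExt]

/-- A nonzero integer `x` has absolute value at least `1`, so `N * x` dominates `y`. This is what
realizes products of sign vectors by honest functions. -/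
theorem sign_lex (N x y : ℤ) (h : |y| < N) :
    SignType.sign (N * x + y) = if SignType.sign x = 0 then SignType.sign y
      else SignType.sign x := by
  obtain ⟨h1, h2⟩ := abs_lt.1 h
  rcases lt_trichotomy x 0 with hx | hx | hx
  · rw [sign_neg hx, sign_neg (by nlinarith)]; rfl
  · simp [hx]
  · rw [sign_pos hx, sign_pos (by nlinarith)]; rfl

theorem oddExt_lin (N : ℤ) (f g : Fin n → ℤ) (a : Pt n) :
    oddExt (fun i => N * f i + g i) a = N * oddExt f a + oddExt g a := by
  rcases a with _ | ⟨i, s⟩ <;> simp only [oddExt] <;> ring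

/-- A bound for all differences of values of `oddExt f`. -/
theorem exists_bound (g : Fin n → ℤ) : ∃ N : ℤ, ∀ a b, |oddExt g b - oddExt g a| < N := by
  obtain ⟨M, hM⟩ := (Set.finite_range fun p : Pt n × Pt n =>
    |oddExt g p.2 - oddExt g p.1|).bddAbove
  exact ⟨M + 1, fun a b => Int.lt_add_one_iff.2 (hM ⟨(a, b), rfl⟩)⟩

theorem exists_sgn_mul (f g : Fin n → ℤ) :
    ∃ k : Fin n → ℤ, sgn f * sgn g = sgn k := by
  obtain ⟨N, hN⟩ := exists_bound g
  -- A large multiple of `f` perturbed by `g`: the differences of `g` matter only where those of `f`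
  -- vanish.
  refine ⟨fun i => N * f i + g i, ?_⟩
  ext a b
  rw [SignVec.mul_toFun, sgn_toFun, sgn_toFun, sgn_toFun, oddExt_lin, oddExt_lin,
    ← sign_lex N _ _ (hN a b)]
  congr 1
  ring

/-! ### Sorted functions -/

/-- A function is sorted if `0 ≤ f 1 ≤ … ≤ f n`. -/
def Sorted (f : Fin n → ℤ) : Prop := (∀ i, 0 ≤ f i) ∧ Monotone f

theorem exists_act_sorted (f : Fin n → ℤ) : ∃ w : SignedPerm n, Sorted (act w f) := by
  set σ := Tuple.sort fun i => |f i| with hσ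
  -- `σ` sorts by absolute value and enters inverted because `act` precomposes with the inverse; the
  -- signs make all values nonnegative.
  refine ⟨⟨fun j => if 0 ≤ f (σ j) then 1 else -1, σ⁻¹⟩, ?_⟩
  have h : act ⟨fun j => if 0 ≤ f (σ j) then 1 else -1, σ⁻¹⟩ f = (fun i => |f i|) ∘ σ := by
    ext j
    simp only [act, inv_inv, Function.comp]
    split_ifs with h
    · simp [abs_of_nonneg h]
    · simp [abs_of_neg (not_le.1 h)]
  rw [h]
  exact ⟨fun i => abs_nonneg _, Tuple.monotone_sort _⟩

theorem abs_act (w : SignedPerm n) (f : Fin n → ℤ) (j : Fin n) :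
    |act w f j| = |f (w.right⁻¹ j)| := by
  simp only [act, abs_mul]
  rcases Int.units_eq_one_or (w.left j) with h | h <;> simp [h]

/-- Sorted functions form a fundamental domain: nonnegativity removes the signs, and two monotone
rearrangements of the same values coincide. -/
theorem act_eq_of_sorted {w : SignedPerm n} {f : Fin n → ℤ} (hf : Sorted f)
    (hw : Sorted (act w f)) : act w f = f := by
  have h : act w f = f ∘ (w.right⁻¹ : Equiv.Perm (Fin n)) := by
    ext j
    have := abs_act w f j
    rwa [abs_of_nonneg (hw.1 j), abs_of_nonneg (hf.1 _)] at this
  have h2 := hw.2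
  rw [h] at h2 ⊢
  exact Tuple.unique_monotone (τ := 1) h2 hf.2

/-- The values `f_0 = 0, f_1, …, f_n`. -/
def entries (f : Fin n → ℤ) : ℕ → ℤ
  | 0 => 0
  | i + 1 => if h : i < n then f ⟨i, h⟩ else 0

/-- The standard sorted function that increases exactly at the positions in `J`. -/
def stdFn (n : ℕ) (J : Finset ℕ) (i : Fin n) : ℤ := #(J.filter fun j => j ≤ (i : ℕ))

theorem entries_succ (f : Fin n → ℤ) (i : Fin n) : entries f (i + 1) = f i := by
  simp [entries]

theorem sorted_of_entries {f : Fin n → ℤ} (h : ∀ i < n, entries f i ≤ entries f (i + 1)) :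
    Sorted f := by
  have key : ∀ j, j ≤ n → ∀ i ≤ j, entries f i ≤ entries f j := by
    intro j
    induction j with
    | zero => intro _ i hi; rw [Nat.le_zero.1 hi]
    | succ j ih =>
      intro hj i hi
      rcases Nat.le_succ_iff.1 hi with h' | h'
      · exact (ih (by omega) i h').trans (h j (by omega))
      · rw [h']
  constructor
  · intro i
    rw [← entries_succ f i]
    exact key (i + 1) i.2 0 (by omega)
  · intro i j hij
    rw [← entries_succ f i, ← entries_succ f j]
    exact key (j + 1) j.2 (i + 1) (by simpa using hij)

theorem Sorted.entries_le {f : Fin n → ℤ} (hf : Sorted f) {i : ℕ} (hi : i < n) :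
    entries f i ≤ entries f (i + 1) := by
  rcases i with _ | i
  · simpa [entries, hi] using hf.1 _
  · have hi' : i < n := by omega
    simp only [entries, hi, hi', dif_pos]
    exact hf.2 (by simp [Fin.le_def])

theorem Sorted.entries_mono {f : Fin n → ℤ} (hf : Sorted f) {i j : ℕ} (hj : j ≤ n)
    (hij : i ≤ j) : entries f i ≤ entries f j := by
  induction j, hij using Nat.le_induction with
  | base => exact le_rfl
  | succ j _ ih => exact (ih (by omega)).trans (hf.entries_le (by omega))

/-- For sorted functions the values compare according to the ascents in between. -/
theorem Sorted.entries_lt_iff {f : Fin n → ℤ} (hf : Sorted f) {j : ℕ} (hj : j ≤ n) (i : ℕ)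
    (hij : i ≤ j) :
    entries f i < entries f j ↔ ∃ k, i ≤ k ∧ k < j ∧ entries f k < entries f (k + 1) := by
  induction j with
  | zero =>
    obtain rfl := Nat.le_zero.1 hij
    simp
  | succ j ih =>
    rcases Nat.le_succ_iff.1 hij with h' | h'
    · have h1 := ih (by omega) h'
      have h2 := hf.entries_le (show j < n by omega)
      have h3 := hf.entries_mono (show j ≤ n by omega) h'
      constructor
      · intro h
        rcases h3.lt_or_eq with h4 | h4
        · obtain ⟨k, a, b, c⟩ := h1.1 h4
          exact ⟨k, a, by omega, c⟩
        · exact ⟨j, h', by omega, h4 ▸ h⟩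
      · rintro ⟨k, a, b, c⟩
        rcases Nat.lt_succ_iff_lt_or_eq.1 b with hk | rfl
        · exact (h1.2 ⟨k, a, hk, c⟩).trans_le h2
        · exact h3.trans_lt c
    · subst h'
      simp only [lt_irrefl, false_iff]
      rintro ⟨k, a, b, -⟩
      omega

theorem sign_eq_iff_lt {x y x' y' : ℤ} (h1 : x < y ↔ x' < y') (h2 : y < x ↔ y' < x') :
    SignType.sign (y - x) = SignType.sign (y' - x') := by
  rcases lt_trichotomy x y with h | h | h
  · rw [sign_pos (by omega), sign_pos (by have := h1.1 h; omega)]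
  · have : y' = x' := by
      have a := mt h1.2 (by omega); have b := mt h2.2 (by omega); omega
    rw [h, this]; simp
  · rw [sign_neg (by omega), sign_neg (by have := h2.1 h; omega)]

/-- For nonnegative functions, comparisons among `0, ±f i, ±f j` depend only on which values are
positive and on the order of the values. -/
theorem sgn_eq_of_lt_iff {f g : Fin n → ℤ} (hf : ∀ i, 0 ≤ f i) (hg : ∀ i, 0 ≤ g i)
    (h0 : ∀ i, 0 < f i ↔ 0 < g i) (h : ∀ i j, f i < f j ↔ g i < g j) : sgn f = sgn g := by
  ext a b
  rw [sgn_toFun, sgn_toFun]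
  rcases a with _ | ⟨i, s⟩ <;> rcases b with _ | ⟨j, t⟩
  · rfl
  · have := hf j; have := hg j; have := h0 j
    rcases Int.units_eq_one_or t with rfl | rfl <;> simp only [oddExt] <;>
      apply sign_eq_iff_lt <;> push_cast <;> omega
  · have := hf i; have := hg i; have := h0 i
    rcases Int.units_eq_one_or s with rfl | rfl <;> simp only [oddExt] <;>
      apply sign_eq_iff_lt <;> push_cast <;> omega
  · have := hf i; have := hg i; have := h0 i
    have := hf j; have := hg j; have := h0 j; have := h i j; have := h j i
    rcases Int.units_eq_one_or s with rfl | rfl <;>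
    rcases Int.units_eq_one_or t with rfl | rfl <;> simp only [oddExt] <;>
      apply sign_eq_iff_lt <;> push_cast <;> omega

/-- The faces of the fundamental chamber are thus determined by their sets of ascents, which makes
`stdFn` a complete list of representatives. -/
theorem Sorted.sgn_eq {f g : Fin n → ℤ} (hf : Sorted f) (hg : Sorted g)
    (h : ∀ i < n, entries f i < entries f (i + 1) ↔ entries g i < entries g (i + 1)) :
    sgn f = sgn g := by
  have key : ∀ j ≤ n, ∀ i ≤ j, entries f i < entries f j ↔ entries g i < entries g j := by
    intro j hj i hij
    rw [hf.entries_lt_iff hj i hij, hg.entries_lt_iff hj i hij]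
    refine exists_congr fun k => and_congr_right fun _ => and_congr_right fun hk => ?_
    exact h k (by omega)
  refine sgn_eq_of_lt_iff hf.1 hg.1 (fun i => ?_) fun i j => ?_
  · have := key (i + 1) i.2 0 (by omega)
    rwa [entries_succ, entries_succ] at this
  · rcases le_or_gt i j with hij | hij
    · have := key (j + 1) j.2 (i + 1) (by simpa using hij)
      rwa [entries_succ, entries_succ, entries_succ, entries_succ] at this
    · have a := hf.2 hij.le
      have b := hg.2 hij.le
      constructor <;> intro <;> omega

/-- The point with the value `entries f i`. -/
def ptOf (n i : ℕ) : Pt n := if h : 0 < i ∧ i - 1 < n then some (⟨i - 1, h.2⟩, 1) else none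

theorem oddExt_ptOf (f : Fin n → ℤ) (i : ℕ) : oddExt f (ptOf n i) = entries f i := by
  rcases i with _ | i
  · simp [ptOf, oddExt, entries]
  · by_cases h : i < n <;> simp [ptOf, oddExt, entries, h]

theorem entries_lt_iff_sgn (f : Fin n → ℤ) (i j : ℕ) :
    entries f i < entries f j ↔ (sgn f).toFun (ptOf n i) (ptOf n j) = 1 := by
  rw [sgn_toFun, oddExt_ptOf, oddExt_ptOf, sign_eq_one_iff, sub_pos]

theorem entries_le_iff_sgn (f : Fin n → ℤ) (i j : ℕ) :
    entries f i ≤ entries f j ↔ (sgn f).toFun (ptOf n i) (ptOf n j) ≠ -1 := by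
  rw [sgn_toFun, oddExt_ptOf, oddExt_ptOf, Ne, sign_eq_neg_one_iff]
  omega

theorem Sorted.of_sgn_eq {f g : Fin n → ℤ} (hf : Sorted f) (h : sgn g = sgn f) : Sorted g :=
  sorted_of_entries fun i hi => by
    rw [entries_le_iff_sgn, h, ← entries_le_iff_sgn]
    exact hf.entries_le hi

theorem entries_stdFn (J : Finset ℕ) {i : ℕ} (hi : i ≤ n) :
    entries (stdFn n J) i = #(J.filter fun j => j < i) := by
  rcases i with _ | i
  · simp [entries]
  · have : i < n := by omega
    simp [entries, this, stdFn]

theorem entries_stdFn_succ (J : Finset ℕ) {i : ℕ} (hi : i < n) :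
    entries (stdFn n J) (i + 1) = entries (stdFn n J) i + if i ∈ J then 1 else 0 := by
  rw [entries_stdFn J hi.le, entries_stdFn J (show i + 1 ≤ n from hi)]
  have : (J.filter fun j => j < i + 1) =
      (J.filter fun j => j < i) ∪ (J.filter fun j => j = i) := by
    ext j; simp only [mem_filter, mem_union]; grind
  rw [this, card_union_of_disjoint, filter_eq']
  · split_ifs <;> simp
  · rw [disjoint_filter]
    intro j _ h1 h2
    omega

theorem sorted_stdFn (J : Finset ℕ) : Sorted (stdFn n J) :=
  sorted_of_entries fun i hi => by
    rw [entries_stdFn_succ J hi]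
    split_ifs <;> omega

theorem entries_stdFn_lt_iff (J : Finset ℕ) {i : ℕ} (hi : i < n) :
    entries (stdFn n J) i < entries (stdFn n J) (i + 1) ↔ i ∈ J := by
  rw [entries_stdFn_succ J hi]
  split_ifs with h <;> simp [h]

theorem exists_sgn_act_eq (f : Fin n → ℤ) :
    ∃ J ⊆ range n, ∃ w : SignedPerm n, sgn f = w • sgn (stdFn n J) := by
  obtain ⟨w, hw⟩ := exists_act_sorted f
  refine ⟨(range n).filter fun i => entries (act w f) i < entries (act w f) (i + 1),
    filter_subset _ _, w⁻¹, ?_⟩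
  rw [eq_inv_smul_iff, smul_sgn]
  refine hw.sgn_eq (sorted_stdFn _) fun i hi => ?_
  rw [entries_stdFn_lt_iff _ hi]
  simp [hi]

/-- The type of a face is well defined: being sorted is visible on the sign vector, and so are the
ascents, so the fundamental domain property applies. -/
theorem eq_of_smul_sgn_eq {I J : Finset ℕ} (hI : I ⊆ range n) (hJ : J ⊆ range n)
    {w : SignedPerm n} (h : w • sgn (stdFn n I) = sgn (stdFn n J)) : I = J := by
  rw [smul_sgn] at h
  have h1 := act_eq_of_sorted (sorted_stdFn I) ((sorted_stdFn J).of_sgn_eq h)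
  rw [h1] at h
  ext i
  by_cases hi : i < n
  · rw [← entries_stdFn_lt_iff I hi, ← entries_stdFn_lt_iff J hi, entries_lt_iff_sgn,
      entries_lt_iff_sgn, h]
  · have a : i ∉ I := fun h' => hi (mem_range.1 (hI h'))
    have b : i ∉ J := fun h' => hi (mem_range.1 (hJ h'))
    simp [a, b]

/-! ### Chambers -/

/-- The fundamental chamber. -/
def chamber₀ (n : ℕ) : SignVec n := sgn (stdFn n (range n))

theorem stdFn_range (i : Fin n) : stdFn n (range n) i = i + 1 := by
  have : (range n).filter (fun j => j ≤ (i : ℕ)) = range (i + 1) := by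
    ext j; simp only [mem_filter, mem_range]; omega
  rw [stdFn, this, card_range]
  push_cast
  rfl

/-- The underlying function takes the values `1, …, n`, so its odd extension separates all points.
-/
theorem eq_of_chamber₀_eq_zero {a b : Pt n} (h : (chamber₀ n).toFun a b = 0) : a = b := by
  rw [chamber₀, sgn_toFun, sign_eq_zero_iff, sub_eq_zero] at h
  rcases a with _ | ⟨i, s⟩ <;> rcases b with _ | ⟨j, t⟩
  · rfl
  · rcases Int.units_eq_one_or t with rfl | rfl <;> simp [oddExt, stdFn_range] at h <;> omega
  · rcases Int.units_eq_one_or s with rfl | rfl <;> simp [oddExt, stdFn_range] at h <;> omega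
  · rcases Int.units_eq_one_or s with rfl | rfl <;>
    rcases Int.units_eq_one_or t with rfl | rfl <;>
    simp [oddExt, stdFn_range] at h ⊢ <;> omega

theorem eq_one_of_smul_chamber₀ {w : SignedPerm n} (h : w • chamber₀ n = chamber₀ n) : w = 1 := by
  rw [chamber₀, smul_sgn] at h
  have h1 := act_eq_of_sorted (sorted_stdFn _) ((sorted_stdFn _).of_sgn_eq h)
  have h2 : ∀ j, w.right⁻¹ j = j ∧ w.left j = 1 := by
    intro j
    have := congrFun h1 j
    simp only [act, stdFn_range] at this
    rcases Int.units_eq_one_or (w.left j) with h' | h' <;> rw [h'] at this ⊢ <;>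
      push_cast at this
    · exact ⟨Fin.ext (by omega), rfl⟩
    · omega
  refine SemidirectProduct.ext (funext fun j => (h2 j).2) ?_
  rw [← inv_inj]
  ext j
  rw [(h2 j).1]
  simp

theorem smul_chamber₀_injective {v w : SignedPerm n} (h : v • chamber₀ n = w • chamber₀ n) :
    v = w := by
  rw [← inv_smul_eq_iff, ← mul_smul] at h
  exact (inv_mul_eq_one.1 (eq_one_of_smul_chamber₀ h)).symm

/-- Only consecutive positions need to be compared: a function ascending at all of them is sorted,
and its face is then `C₀`. -/
theorem sgn_mul_eq_chamber₀_iff {f g : Fin n → ℤ} :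
    sgn f * sgn g = chamber₀ n ↔ ∀ i < n, entries f i < entries f (i + 1) ∨
      entries f i = entries f (i + 1) ∧ entries g i < entries g (i + 1) := by
  obtain ⟨k, hk⟩ := exists_sgn_mul f g
  have h1 : ∀ i, entries k i < entries k (i + 1) ↔ (entries f i < entries f (i + 1) ∨
      entries f i = entries f (i + 1) ∧ entries g i < entries g (i + 1)) := by
    intro i
    rw [entries_lt_iff_sgn, ← hk, SignVec.mul_toFun, entries_lt_iff_sgn, entries_lt_iff_sgn g]
    have : entries f i = entries f (i + 1) ↔ (sgn f).toFun (ptOf n i) (ptOf n (i + 1)) = 0 := by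
      rw [sgn_toFun, oddExt_ptOf, oddExt_ptOf, sign_eq_zero_iff, sub_eq_zero, eq_comm]
    rw [this]
    split_ifs with h <;> simp [h]
  rw [hk]
  simp only [← h1]
  constructor
  · intro h i hi
    rw [entries_lt_iff_sgn, h, chamber₀, ← entries_lt_iff_sgn, entries_stdFn_lt_iff _ hi]
    exact mem_range.2 hi
  · intro h
    refine Sorted.sgn_eq (sorted_of_entries fun i hi => (h i hi).le) (sorted_stdFn _)
      fun i hi => ?_
    rw [entries_stdFn_lt_iff _ hi]
    simp [h i hi, hi]

theorem exists_mul_chamber₀ (f : Fin n → ℤ) :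
    ∃ w : SignedPerm n, sgn f * chamber₀ n = w • chamber₀ n := by
  obtain ⟨k, hk⟩ := exists_sgn_mul f (stdFn n (range n))
  obtain ⟨J, hJ, w, hw⟩ := exists_sgn_act_eq k
  -- A position outside `J` would produce a vanishing coordinate of the product at two distinct
  -- points, although `C₀` vanishes only on the diagonal.
  have : J = range n := by
    refine hJ.antisymm fun i hi => ?_
    have hi := mem_range.1 hi
    by_contra hc
    rw [← entries_stdFn_lt_iff J hi, not_lt] at hc
    have h0 : (sgn (stdFn n J)).toFun (ptOf n i) (ptOf n (i + 1)) = 0 := by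
      rw [sgn_toFun, oddExt_ptOf, oddExt_ptOf, sign_eq_zero_iff, sub_eq_zero]
      exact hc.antisymm ((sorted_stdFn J).entries_le hi)
    have h1 : (w⁻¹ • (sgn f * chamber₀ n)) = sgn (stdFn n J) := by
      rw [chamber₀, hk, hw, inv_smul_smul]
    rw [← h1, SignVec.smul_toFun, SignVec.mul_toFun] at h0
    have h2 : (chamber₀ n).toFun (actPt w⁻¹⁻¹ (ptOf n i)) (actPt w⁻¹⁻¹ (ptOf n (i + 1))) = 0 := by
      split_ifs at h0 with h
      · exact h0
      · exact absurd h0 h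
    have h3 := congrArg (actPt w⁻¹) (eq_of_chamber₀_eq_zero h2)
    rw [← actPt_mul, ← actPt_mul, mul_inv_cancel, actPt_one, actPt_one] at h3
    have h4 := oddExt_ptOf (stdFn n (range n)) i
    rw [h3, oddExt_ptOf, entries_stdFn_succ _ hi, if_pos (mem_range.2 hi)] at h4
    omega
  exact ⟨w, by rw [chamber₀, hk, hw, this]⟩

/-! ### From faces to signed permutations and their descents -/

/-- The signed permutation `w` with `F C₀ = w C₀`. -/
def toPerm (F : SignVec n) : SignedPerm n :=
  -- The default `1` is never taken on the sign vector of a function, by `exists_mul_chamber₀`.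
  open Classical in if h : ∃ w : SignedPerm n, F * chamber₀ n = w • chamber₀ n then h.choose else 1

theorem toPerm_eq {F : SignVec n} {w : SignedPerm n} (h : F * chamber₀ n = w • chamber₀ n) :
    toPerm F = w := by
  have h' : ∃ w : SignedPerm n, F * chamber₀ n = w • chamber₀ n := ⟨w, h⟩
  rw [toPerm, dif_pos h']
  exact smul_chamber₀_injective (h'.choose_spec.symm.trans h)

theorem mul_chamber₀ (f : Fin n → ℤ) : sgn f * chamber₀ n = toPerm (sgn f) • chamber₀ n := by
  obtain ⟨w, hw⟩ := exists_mul_chamber₀ f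
  rw [hw, toPerm_eq hw]

/-- This reads the word of `w` as coordinates of a point in the chamber `w⁻¹ C₀`. -/
theorem entryB_eq (w : SignedPerm n) (i : ℕ) :
    entryB w i = entries (act w⁻¹ (stdFn n (range n))) i := by
  rcases i with _ | i
  · rfl
  · simp only [entryB, entries]
    split_ifs with h
    · have e : (w⁻¹.left ⟨i, h⟩ : ℤˣ) = (w.left (w.right ⟨i, h⟩))⁻¹ := by
        rw [SemidirectProduct.inv_left]
        rfl
      rw [act, e, SemidirectProduct.inv_right, inv_inv, stdFn_range, Int.units_inv_eq_self]
    · rfl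

/-- The standard face already ascends at the positions in `J`; at every other position it has a tie,
which `w⁻¹ C₀` must break by an ascent of `w`. -/
theorem desB_subset_iff (w : SignedPerm n) (J : Finset ℕ) :
    desB w ⊆ J ↔ sgn (stdFn n J) * (w⁻¹ • chamber₀ n) = chamber₀ n := by
  rw [chamber₀, smul_sgn, ← chamber₀, sgn_mul_eq_chamber₀_iff]
  simp only [← entryB_eq, subset_iff, desB, mem_filter, mem_range]
  have key : ∀ i < n, (entryB w (i + 1) < entryB w i → i ∈ J) ↔
      (entries (stdFn n J) i < entries (stdFn n J) (i + 1) ∨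
      entries (stdFn n J) i = entries (stdFn n J) (i + 1) ∧ entryB w i < entryB w (i + 1)) := by
    intro i hi
    -- Chambers have no ties between distinct points, so not descending means ascending.
    have hne : entryB w i ≠ entryB w (i + 1) := by
      intro h
      rw [entryB_eq, entryB_eq, ← oddExt_ptOf, ← oddExt_ptOf, ← sub_eq_zero, ← sign_eq_zero_iff,
        ← sgn_toFun, ← smul_sgn, SignVec.smul_toFun] at h
      have h3 := congrArg (actPt w⁻¹) (eq_of_chamber₀_eq_zero h)
      rw [← actPt_mul, ← actPt_mul, mul_inv_cancel, actPt_one, actPt_one] at h3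
      have h4 := oddExt_ptOf (stdFn n (range n)) i
      rw [← h3, oddExt_ptOf, entries_stdFn_succ _ hi, if_pos (mem_range.2 hi)] at h4
      omega
    rw [entries_stdFn_lt_iff J hi, entries_stdFn_succ J hi]
    split_ifs with h
    · simp [h]
    · simp only [h, imp_false, not_lt, false_or, add_zero, true_and]
      omega
  constructor
  · intro h i hi
    exact (key i hi).1 fun h' => h ⟨hi, h'⟩
  · rintro h i ⟨hi, h'⟩
    exact (key i hi).2 (h i hi) h'

end SignVectors

/-! ### The algebra of invariant combinations of faces -/

section FaceAlgebra

variable {n : ℕ}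

/-- The faces in the orbit of the standard face of type `J`. -/
def faceOrbit (n : ℕ) (J : Finset ℕ) : Finset (SignVec n) :=
  open Classical in univ.filter fun F => ∃ w : SignedPerm n, w • sgn (stdFn n J) = F

theorem mem_faceOrbit {J : Finset ℕ} {F : SignVec n} :
    F ∈ faceOrbit n J ↔ ∃ w : SignedPerm n, w • sgn (stdFn n J) = F := by
  simp [faceOrbit]

theorem smul_mem_faceOrbit {J : Finset ℕ} {F : SignVec n} (w : SignedPerm n)
    (h : F ∈ faceOrbit n J) : w • F ∈ faceOrbit n J := by
  obtain ⟨v, rfl⟩ := mem_faceOrbit.1 h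
  exact mem_faceOrbit.2 ⟨w * v, mul_smul _ _ _⟩

theorem exists_sgn_of_mem_faceOrbit {J : Finset ℕ} {F : SignVec n} (h : F ∈ faceOrbit n J) :
    ∃ w : SignedPerm n, sgn (act w (stdFn n J)) = F := by
  obtain ⟨v, rfl⟩ := mem_faceOrbit.1 h
  exact ⟨v, (smul_sgn _ _).symm⟩

theorem faceOrbit_injOn {I J : Finset ℕ} (hI : I ⊆ range n) (hJ : J ⊆ range n) {F : SignVec n}
    (h : F ∈ faceOrbit n I) (h' : F ∈ faceOrbit n J) : I = J := by
  obtain ⟨v, rfl⟩ := mem_faceOrbit.1 h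
  obtain ⟨w, hw⟩ := mem_faceOrbit.1 h'
  refine eq_of_smul_sgn_eq hI hJ (w := w⁻¹ * v) ?_
  rw [mul_smul, ← hw, inv_smul_smul]

/-- The sum of all faces of type `J`. -/
def orbitSum (n : ℕ) (J : Finset ℕ) : MonoidAlgebra ℚ (SignVec n) :=
  ∑ F ∈ faceOrbit n J, MonoidAlgebra.single F 1

theorem coeff_orbitSum (J : Finset ℕ) (F : SignVec n) :
    (orbitSum n J).coeff F = if F ∈ faceOrbit n J then 1 else 0 := by
  simp only [orbitSum, MonoidAlgebra.coeff_sum, Finsupp.finsetSum_apply,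
    MonoidAlgebra.coeff_single, Finsupp.single_apply]
  simp

/-- The span of the orbit sums. -/
def faceInv (n : ℕ) : Submodule ℚ (MonoidAlgebra ℚ (SignVec n)) :=
  Submodule.span ℚ (Set.range (orbitSum n))

theorem orbitSum_mem (J : Finset ℕ) : orbitSum n J ∈ faceInv n :=
  Submodule.subset_span ⟨J, rfl⟩

/-- Invariant coefficients are constant on orbits, so they can be read off at the standard face of
each type. -/
theorem mem_faceInv_of_invariant {a : MonoidAlgebra ℚ (SignVec n)}
    (h1 : ∀ F, a.coeff F ≠ 0 → ∃ f, F = sgn f)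
    (h2 : ∀ (w : SignedPerm n) (F : SignVec n), a.coeff (w • F) = a.coeff F) :
    a ∈ faceInv n := by
  have : a = ∑ J ∈ (range n).powerset, a.coeff (sgn (stdFn n J)) • orbitSum n J := by
    ext F
    simp only [MonoidAlgebra.coeff_sum, Finsupp.finsetSum_apply, MonoidAlgebra.coeff_smul,
      Finsupp.smul_apply, coeff_orbitSum, smul_eq_mul, mul_ite, mul_one, mul_zero]
    by_cases hF : ∃ f, F = sgn f
    · obtain ⟨f, rfl⟩ := hF
      obtain ⟨J, hJ, w, hw⟩ := exists_sgn_act_eq f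
      have hm : sgn f ∈ faceOrbit n J := mem_faceOrbit.2 ⟨w, hw.symm⟩
      rw [sum_eq_single_of_mem J (mem_powerset.2 hJ), if_pos hm, hw, h2]
      intro I hI hne
      exact if_neg fun h => hne (faceOrbit_injOn (mem_powerset.1 hI) hJ h hm)
    · rw [sum_eq_zero]
      · by_contra hc
        exact hF (h1 F hc)
      · intro J _
        refine if_neg fun h => hF ?_
        obtain ⟨w, hw⟩ := exists_sgn_of_mem_faceOrbit h
        exact ⟨_, hw.symm⟩
  rw [this]
  exact Submodule.sum_mem _ fun J _ => Submodule.smul_mem _ _ (orbitSum_mem J)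

theorem orbitSum_mul (I J : Finset ℕ) : orbitSum n I * orbitSum n J =
    ∑ p ∈ faceOrbit n I ×ˢ faceOrbit n J, MonoidAlgebra.single (p.1 * p.2) 1 := by
  rw [orbitSum, orbitSum, sum_mul_sum, sum_product]
  simp only [MonoidAlgebra.single_mul_single, mul_one]

theorem coeff_orbitSum_mul (I J : Finset ℕ) (F : SignVec n) :
    (orbitSum n I * orbitSum n J).coeff F =
      #((faceOrbit n I ×ˢ faceOrbit n J).filter fun p => p.1 * p.2 = F) := by
  simp only [orbitSum_mul, MonoidAlgebra.coeff_sum, Finsupp.finsetSum_apply,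
    MonoidAlgebra.coeff_single, Finsupp.single_apply]
  simp

/-- Signed permutations act by automorphisms of the face monoid, so moving both factors at once
shows that the number of factorizations of a face is constant on orbits. -/
theorem faceInv_mul_mem {a b : MonoidAlgebra ℚ (SignVec n)} (ha : a ∈ faceInv n)
    (hb : b ∈ faceInv n) : a * b ∈ faceInv n := by
  have key : ∀ I J, orbitSum n I * orbitSum n J ∈ faceInv n := by
    intro I J
    apply mem_faceInv_of_invariant
    · intro F hF
      rw [coeff_orbitSum_mul] at hF
      obtain ⟨⟨G, H⟩, hp⟩ := Finset.card_pos.1 (Nat.pos_of_ne_zero (by exact_mod_cast hF))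
      obtain ⟨hm, rfl⟩ := mem_filter.1 hp
      obtain ⟨hG, hH⟩ := mem_product.1 hm
      obtain ⟨v, rfl⟩ := exists_sgn_of_mem_faceOrbit hG
      obtain ⟨w, rfl⟩ := exists_sgn_of_mem_faceOrbit hH
      exact exists_sgn_mul _ _
    · intro w F
      rw [coeff_orbitSum_mul, coeff_orbitSum_mul]
      congr 1
      refine card_bij' (fun p _ => (w⁻¹ • p.1, w⁻¹ • p.2)) (fun p _ => (w • p.1, w • p.2))
        ?_ ?_ ?_ ?_
      · rintro ⟨G, H⟩ hp
        obtain ⟨hm, hGH⟩ := mem_filter.1 hp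
        obtain ⟨hG, hH⟩ := mem_product.1 hm
        refine mem_filter.2 ⟨mem_product.2 ⟨smul_mem_faceOrbit _ hG, smul_mem_faceOrbit _ hH⟩, ?_⟩
        rw [← SignVec.smul_mul, hGH, inv_smul_smul]
      · rintro ⟨G, H⟩ hp
        obtain ⟨hm, rfl⟩ := mem_filter.1 hp
        obtain ⟨hG, hH⟩ := mem_product.1 hm
        exact mem_filter.2 ⟨mem_product.2 ⟨smul_mem_faceOrbit _ hG, smul_mem_faceOrbit _ hH⟩,
          (SignVec.smul_mul _ _ _).symm⟩
      · rintro ⟨G, H⟩ -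
        simp
      · rintro ⟨G, H⟩ -
        simp
  induction ha using Submodule.span_induction with
  | mem x hx =>
    obtain ⟨I, rfl⟩ := hx
    induction hb using Submodule.span_induction with
    | mem y hy => obtain ⟨J, rfl⟩ := hy; exact key I J
    | zero => rw [mul_zero]; exact Submodule.zero_mem _
    | add x y _ _ h1 h2 => rw [mul_add]; exact Submodule.add_mem _ h1 h2
    | smul c x _ h => rw [mul_smul_comm]; exact Submodule.smul_mem _ _ h
  | zero => rw [zero_mul]; exact Submodule.zero_mem _
  | add x y _ _ h1 h2 => rw [add_mul]; exact Submodule.add_mem _ h1 h2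
  | smul c x _ h => rw [smul_mul_assoc]; exact Submodule.smul_mem _ _ h

theorem orbitSum_empty : orbitSum n ∅ = 1 := by
  have h : sgn (stdFn n ∅) = 1 := by
    rw [← sgn_zero]
    congr 1
  have : faceOrbit n ∅ = {1} := by
    ext F
    rw [mem_faceOrbit, mem_singleton, h]
    constructor
    · rintro ⟨w, rfl⟩; exact SignVec.smul_one w
    · rintro rfl; exact ⟨1, one_smul _ _⟩
  rw [orbitSum, this, sum_singleton, MonoidAlgebra.one_def]

/-! ### The anti-morphism from invariant faces to the descent algebra -/

/-- The linear map that sends a face `F` to the signed permutation `w` with `F C₀ = w C₀`. -/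
def faceToPerm (n : ℕ) :
    MonoidAlgebra ℚ (SignVec n) →ₗ[ℚ] MonoidAlgebra ℚ (SignedPerm n) :=
  MonoidAlgebra.mapDomainLinearMap ℚ ℚ toPerm

theorem faceToPerm_single (F : SignVec n) (c : ℚ) :
    faceToPerm n (MonoidAlgebra.single F c) = MonoidAlgebra.single (toPerm F) c := by
  simp [faceToPerm]

theorem faceToPerm_one : faceToPerm n 1 = 1 := by
  rw [MonoidAlgebra.one_def, faceToPerm_single, MonoidAlgebra.one_def]
  congr 1
  exact toPerm_eq (by rw [one_mul, one_smul])

/-- With `v = toPerm (sgn g)`, `F G C₀ = F (v C₀) = v ((v⁻¹ F) C₀)`. The order is reversed and `F`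
is twisted by `v⁻¹`; the twist disappears when summing over an orbit. -/
theorem toPerm_mul (f g : Fin n → ℤ) :
    toPerm (sgn f * sgn g) = toPerm (sgn g) * toPerm ((toPerm (sgn g))⁻¹ • sgn f) := by
  apply toPerm_eq
  rw [mul_smul, smul_sgn, ← mul_chamber₀, SignVec.smul_mul, ← smul_sgn, smul_inv_smul,
    ← mul_chamber₀, mul_assoc]

/-- The map `w ↦ w F_J`, with `F_J` the standard face, is a bijection from the `w` with descents in
`J` to the faces of type `J`, and `toPerm` inverts it. -/
theorem faceToPerm_orbitSum (J : Finset ℕ) : faceToPerm n (orbitSum n J) = X n J := by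
  rw [orbitSum, map_sum, X]
  simp only [faceToPerm_single]
  have h1 : ∀ w : SignedPerm n, desB w ⊆ J → toPerm (w • sgn (stdFn n J)) = w := by
    intro w hw
    apply toPerm_eq
    rw [desB_subset_iff] at hw
    rw [← smul_inv_smul w (chamber₀ n), ← SignVec.smul_mul, hw, smul_inv_smul]
  symm
  refine sum_bij (fun w _ => w • sgn (stdFn n J)) ?_ ?_ ?_ ?_
  · exact fun w _ => mem_faceOrbit.2 ⟨w, rfl⟩
  · intro v hv w hw h
    rw [← h1 v (mem_filter.1 hv).2, h, h1 w (mem_filter.1 hw).2]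
  · intro F hF
    obtain ⟨v, rfl⟩ := exists_sgn_of_mem_faceOrbit hF
    set w := toPerm (sgn (act v (stdFn n J))) with hw
    have h2 : sgn (act v (stdFn n J)) * chamber₀ n = w • chamber₀ n := mul_chamber₀ _
    have h3 : sgn (act (w⁻¹ * v) (stdFn n J)) * (w⁻¹ • chamber₀ n) = chamber₀ n := by
      rw [act_mul, ← smul_sgn, ← SignVec.smul_mul, inv_smul_eq_iff, h2]
    -- The moved face times a chamber is `C₀`, so it is a face of `C₀`, hence sorted, hence the
    -- standard one.
    have h4 : act (w⁻¹ * v) (stdFn n J) = stdFn n J := by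
      refine act_eq_of_sorted (sorted_stdFn J) (sorted_of_entries fun i hi => ?_)
      have h5 := h3
      rw [chamber₀, smul_sgn, ← chamber₀, sgn_mul_eq_chamber₀_iff] at h5
      rcases h5 i hi with h | h
      · exact h.le
      · exact h.1.le
    rw [h4] at h3
    refine ⟨w, mem_filter.2 ⟨mem_univ _, (desB_subset_iff _ _).2 h3⟩, ?_⟩
    rw [smul_sgn]
    conv_lhs => rw [← h4]
    rw [← act_mul, mul_inv_cancel_left]
  · intro w hw
    rw [h1 w (mem_filter.1 hw).2]
    rfl

theorem faceToPerm_mul {a b : MonoidAlgebra ℚ (SignVec n)} (ha : a ∈ faceInv n)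
    (hb : b ∈ faceInv n) : faceToPerm n (a * b) = faceToPerm n b * faceToPerm n a := by
  have key : ∀ I J, faceToPerm n (orbitSum n I * orbitSum n J) =
      faceToPerm n (orbitSum n J) * faceToPerm n (orbitSum n I) := by
    intro I J
    rw [orbitSum_mul, sum_product_right]
    simp only [orbitSum, map_sum, sum_mul_sum, faceToPerm_single,
      MonoidAlgebra.single_mul_single, mul_one]
    refine sum_congr rfl fun G hG => ?_
    obtain ⟨v, rfl⟩ := exists_sgn_of_mem_faceOrbit hG
    set w := toPerm (sgn (act v (stdFn n J))) with hw
    -- With the second factor `G` fixed, the twist of `toPerm_mul` only permutes the orbit of the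
    -- first.
    refine sum_bij' (fun F _ => w⁻¹ • F) (fun F _ => w • F)
      (fun F hF => smul_mem_faceOrbit _ hF) (fun F hF => smul_mem_faceOrbit _ hF)
      (fun F _ => smul_inv_smul _ _) (fun F _ => inv_smul_smul _ _) ?_
    intro F hF
    obtain ⟨u, rfl⟩ := exists_sgn_of_mem_faceOrbit hF
    rw [toPerm_mul]
  induction ha using Submodule.span_induction with
  | mem x hx =>
    obtain ⟨I, rfl⟩ := hx
    induction hb using Submodule.span_induction with
    | mem y hy => obtain ⟨J, rfl⟩ := hy; exact key I J
    | zero => simp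
    | add x y _ _ h1 h2 => rw [mul_add, map_add, h1, h2, map_add, add_mul]
    | smul c x _ h => rw [mul_smul_comm, map_smul, h, map_smul, smul_mul_assoc]
  | zero => simp
  | add x y _ _ h1 h2 => rw [add_mul, map_add, h1, h2, map_add, mul_add]
  | smul c x _ h => rw [smul_mul_assoc, map_smul, h, map_smul, mul_smul_comm]

theorem descentB_eq_span_X (n : ℕ) : descentB n = Submodule.span ℚ (Set.range (X n)) := by
  apply le_antisymm
  · intro x hx
    have h := Submodule.mem_map_of_mem (f := (descentB n).subtype)
      (span_xElem n (Submodule.mem_top (x := ⟨x, hx⟩)))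
    rw [Submodule.map_span] at h
    refine Submodule.span_mono ?_ h
    rintro _ ⟨_, ⟨J, rfl⟩, rfl⟩
    exact ⟨J, rfl⟩
  · rw [Submodule.span_le]
    rintro _ ⟨J, rfl⟩
    exact X_mem n J

theorem map_faceInv (n : ℕ) : (faceInv n).map (faceToPerm n) = descentB n := by
  rw [faceInv, Submodule.map_span, descentB_eq_span_X, ← Set.range_comp]
  congr 2
  ext1 J
  exact faceToPerm_orbitSum J

theorem faceToPerm_mem {a : MonoidAlgebra ℚ (SignVec n)} (ha : a ∈ faceInv n) :
    faceToPerm n a ∈ descentB n := by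
  rw [← map_faceInv]
  exact Submodule.mem_map_of_mem ha

theorem exists_faceToPerm_eq {x : MonoidAlgebra ℚ (SignedPerm n)} (hx : x ∈ descentB n) :
    ∃ a ∈ faceInv n, faceToPerm n a = x := by
  rwa [← map_faceInv] at hx

theorem isSubalgebra_descentB (n : ℕ) : IsSubalgebra (descentB n) where
  one_mem := by
    rw [← faceToPerm_one, ← orbitSum_empty]
    exact faceToPerm_mem (orbitSum_mem _)
  mul_mem := by
    intro x hx y hy
    obtain ⟨a, ha, rfl⟩ := exists_faceToPerm_eq hx
    obtain ⟨b, hb, rfl⟩ := exists_faceToPerm_eq hy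
    rw [← faceToPerm_mul hb ha]
    exact faceToPerm_mem (faceInv_mul_mem hb ha)

end FaceAlgebra

/-! ### Restriction of faces -/

section Restriction

variable {n : ℕ}

/-- The inclusion of points that skips the first coordinate. -/
def succPt : Pt n → Pt (n + 1)
  | none => none
  | some (i, s) => some (i.succ, s)

/-- Forget the first coordinate. -/
def SignVec.restrict (F : SignVec (n + 1)) : SignVec n :=
  ⟨fun a b => F.toFun (succPt a) (succPt b)⟩

/-- The monoid morphism that restricts the faces with vanishing first coordinate, and kills the
other ones. -/
def restrictHom (n : ℕ) : SignVec (n + 1) →* MonoidAlgebra ℚ (SignVec n) where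
  toFun F := if F.toFun none (some (0, 1)) = 0 then MonoidAlgebra.single F.restrict 1 else 0
  map_one' := by
    rw [if_pos (SignVec.one_toFun _ _)]
    rfl
  map_mul' F G := by
    -- A coordinate of a product vanishes exactly when it vanishes in both factors.
    rw [SignVec.mul_toFun]
    by_cases h : F.toFun none (some (0, 1)) = 0
    · by_cases h' : G.toFun none (some (0, 1)) = 0
      · simp only [h, h', if_true, MonoidAlgebra.single_mul_single, mul_one]
        rfl
      · simp [h, h']
    · simp [h]

/-- The linear extension of `restrictHom`. -/
def faceRestrict (n : ℕ) :
    MonoidAlgebra ℚ (SignVec (n + 1)) →ₐ[ℚ] MonoidAlgebra ℚ (SignVec n) :=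
  MonoidAlgebra.lift ℚ _ _ (restrictHom n)

theorem oddExt_succPt (f : Fin (n + 1) → ℤ) (a : Pt n) :
    oddExt f (succPt a) = oddExt (fun i => f i.succ) a := by
  rcases a with _ | ⟨i, s⟩ <;> rfl

theorem restrict_sgn (f : Fin (n + 1) → ℤ) :
    (sgn f).restrict = sgn fun i => f i.succ := by
  ext a b
  simp only [SignVec.restrict, sgn_toFun, oddExt_succPt]

theorem sgn_zero_iff (f : Fin (n + 1) → ℤ) :
    (sgn f).toFun none (some (0, 1)) = 0 ↔ f 0 = 0 := by
  rw [sgn_toFun, sign_eq_zero_iff]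
  simp [oddExt]

/-- Prepending `0` creates no new values: each point of the larger set takes the value of a point of
the smaller one. -/
theorem sgn_cons_eq {f g : Fin n → ℤ} (h : sgn f = sgn g) :
    sgn (Fin.cons 0 f : Fin (n + 1) → ℤ) = sgn (Fin.cons 0 g : Fin (n + 1) → ℤ) := by
  have key : ∀ a : Pt (n + 1), ∃ b : Pt n, ∀ f : Fin n → ℤ,
      oddExt (Fin.cons 0 f : Fin (n + 1) → ℤ) a = oddExt f b := by
    rintro (_ | ⟨i, s⟩)
    · exact ⟨none, fun f => rfl⟩
    · refine Fin.cases ⟨none, fun f => ?_⟩ (fun i => ⟨some (i, s), fun f => ?_⟩) i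
      · simp [oddExt]
      · simp [oddExt]
  ext a b
  obtain ⟨a', ha⟩ := key a
  obtain ⟨b', hb⟩ := key b
  rw [sgn_toFun, sgn_toFun, ha, ha, hb, hb, ← sgn_toFun, ← sgn_toFun, h]

/-- This is the embedding of signed permutations that fixes the new first coordinate. -/
theorem exists_act_cons (w : SignedPerm n) : ∃ v : SignedPerm (n + 1), ∀ f : Fin n → ℤ,
    act v (Fin.cons 0 f) = Fin.cons 0 (act w f) := by
  refine ⟨⟨Fin.cons 1 w.left, Equiv.Perm.decomposeFin.symm (0, w.right)⟩, fun f => ?_⟩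
  set v : SignedPerm (n + 1) := ⟨Fin.cons 1 w.left, Equiv.Perm.decomposeFin.symm (0, w.right)⟩
  ext j
  refine Fin.cases ?_ (fun i => ?_) j
  · have h : v.right 0 = 0 := by simp [v]
    have := act_apply_right v (Fin.cons 0 f) 0
    rw [h] at this
    rw [this]
    simp
  · obtain ⟨i, rfl⟩ := w.right.surjective i
    have h : v.right i.succ = (w.right i).succ := by simp [v]
    have := act_apply_right v (Fin.cons 0 f) i.succ
    rw [h] at this
    rw [this]
    simp [v, act_apply_right]

theorem stdFn_zero_eq_zero_iff (J : Finset ℕ) : stdFn (n + 1) J 0 = 0 ↔ 0 ∉ J := by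
  simp only [stdFn]
  simp [filter_eq_empty_iff]

theorem stdFn_eq_cons {J : Finset ℕ} (h0 : 0 ∉ J) :
    stdFn (n + 1) J = Fin.cons 0 (stdFn n (J.image (· - 1))) := by
  ext i
  refine Fin.cases ?_ (fun i => ?_) i
  · simpa using (stdFn_zero_eq_zero_iff J).2 h0
  · simp only [stdFn, Fin.cons_succ, Fin.val_succ]
    norm_cast
    refine card_bij (fun j _ => j - 1) ?_ ?_ ?_
    · intro j hj
      obtain ⟨h1, h2⟩ := mem_filter.1 hj
      exact mem_filter.2 ⟨mem_image_of_mem _ h1, by omega⟩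
    · intro j hj k hk h
      have : j ≠ 0 := fun h => h0 (h ▸ (mem_filter.1 hj).1)
      have : k ≠ 0 := fun h => h0 (h ▸ (mem_filter.1 hk).1)
      omega
    · intro k hk
      obtain ⟨h1, h2⟩ := mem_filter.1 hk
      obtain ⟨j, hj, rfl⟩ := mem_image.1 h1
      exact ⟨j, mem_filter.2 ⟨hj, by omega⟩, rfl⟩

/-- If `0 ∈ J`, no coordinate of a face of type `J` vanishes. Otherwise, dropping a zero first
coordinate is inverted by prepending `0`, and the types correspond by the shift. -/
theorem faceRestrict_orbitSum {J : Finset ℕ} (hJ : J ⊆ range (n + 1)) :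
    faceRestrict n (orbitSum (n + 1) J) =
      if 0 ∈ J then 0 else orbitSum n (J.image (· - 1)) := by
  have h1 : faceRestrict n (orbitSum (n + 1) J) = ∑ F ∈ (faceOrbit (n + 1) J).filter
      (fun F => F.toFun none (some (0, 1)) = 0), MonoidAlgebra.single F.restrict 1 := by
    rw [orbitSum, map_sum, sum_filter]
    refine sum_congr rfl fun F _ => ?_
    rw [faceRestrict, MonoidAlgebra.lift_single, one_smul]
    rfl
  rw [h1]
  split_ifs with h0
  · apply sum_eq_zero
    intro F hF
    exfalso
    obtain ⟨hF, hz⟩ := mem_filter.1 hF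
    obtain ⟨w, rfl⟩ := exists_sgn_of_mem_faceOrbit hF
    rw [sgn_zero_iff, ← abs_eq_zero, abs_act, abs_eq_zero] at hz
    -- Up to sign, the vanishing coordinate is some entry of the standard function, so the least
    -- entry vanishes too.
    have h2 := (sorted_stdFn (n := n + 1) J).2 (Fin.zero_le (w.right⁻¹ 0))
    have h3 := (sorted_stdFn (n := n + 1) J).1 0
    rw [hz] at h2
    exact (stdFn_zero_eq_zero_iff J).1 (h2.antisymm h3) h0
  · have hJ' : J.image (· - 1) ⊆ range n := by
      intro i hi
      obtain ⟨j, hj, rfl⟩ := mem_image.1 hi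
      have : j ≠ 0 := fun h => h0 (h ▸ hj)
      have := mem_range.1 (hJ hj)
      exact mem_range.2 (by omega)
    have hcons : ∀ f : Fin (n + 1) → ℤ, f 0 = 0 → f = Fin.cons 0 fun i => f i.succ := by
      intro f hf
      rw [← hf]
      exact (Fin.cons_self_tail f).symm
    rw [orbitSum]
    refine sum_bij (fun F _ => F.restrict) ?_ ?_ ?_ (fun _ _ => rfl)
    · intro F hF
      obtain ⟨hF, hz⟩ := mem_filter.1 hF
      obtain ⟨w, rfl⟩ := exists_sgn_of_mem_faceOrbit hF
      rw [sgn_zero_iff] at hz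
      set f := act w (stdFn (n + 1) J) with hf
      obtain ⟨K, hK, v, hv⟩ := exists_sgn_act_eq fun i => f i.succ
      rw [restrict_sgn, hv]
      suffices h : K = J.image (· - 1) by
        rw [h]
        exact mem_faceOrbit.2 ⟨v, rfl⟩
      obtain ⟨u, hu⟩ := exists_act_cons v
      have h0' : (0 : ℕ) ∉ K.image (· + 1) := by simp
      have hKi : (K.image (· + 1)).image (· - 1) = K := by
        simp [image_image, Function.comp_def]
      have h2 : sgn f ∈ faceOrbit (n + 1) (K.image (· + 1)) := by
        refine mem_faceOrbit.2 ⟨u, ?_⟩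
        rw [stdFn_eq_cons h0', hKi, smul_sgn, hu, hcons f hz]
        rw [smul_sgn] at hv
        exact sgn_cons_eq hv.symm
      -- The same face has both types, and the type is unique.
      have h3 : K.image (· + 1) = J := by
        refine faceOrbit_injOn ?_ hJ h2 hF
        intro i hi
        obtain ⟨j, hj, rfl⟩ := mem_image.1 hi
        have := mem_range.1 (hK hj)
        exact mem_range.2 (by omega)
      rw [← h3, hKi]
    · intro F hF G hG h
      obtain ⟨hF, hz⟩ := mem_filter.1 hF
      obtain ⟨v, rfl⟩ := exists_sgn_of_mem_faceOrbit hF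
      obtain ⟨hG, hz'⟩ := mem_filter.1 hG
      obtain ⟨w, rfl⟩ := exists_sgn_of_mem_faceOrbit hG
      rw [sgn_zero_iff] at hz hz'
      simp only [restrict_sgn] at h
      rw [hcons _ hz, hcons _ hz']
      exact sgn_cons_eq h
    · intro G hG
      obtain ⟨w, rfl⟩ := exists_sgn_of_mem_faceOrbit hG
      obtain ⟨u, hu⟩ := exists_act_cons w
      refine ⟨sgn (Fin.cons 0 (act w (stdFn n (J.image (· - 1))))), mem_filter.2 ⟨?_, ?_⟩, ?_⟩
      · refine mem_faceOrbit.2 ⟨u, ?_⟩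
        rw [smul_sgn, stdFn_eq_cons h0, hu]
      · rw [sgn_zero_iff]; rfl
      · rw [restrict_sgn]; rfl

/-- `faceInv` is spanned over all finite `J`, whereas the formula for `β` needs `J ⊆ range n`. -/
theorem orbitSum_inter (J : Finset ℕ) : orbitSum n (J ∩ range n) = orbitSum n J := by
  have : stdFn n (J ∩ range n) = stdFn n J := by
    ext i
    simp only [stdFn]
    congr 2
    ext j
    have := i.2
    simp only [mem_filter, mem_inter, mem_range]
    constructor
    · rintro ⟨⟨a, -⟩, c⟩; exact ⟨a, c⟩
    · rintro ⟨a, c⟩; exact ⟨⟨a, by omega⟩, c⟩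
  rw [orbitSum, orbitSum, faceOrbit, faceOrbit, this]

/-- By linearity it suffices to compare on orbit sums, where restriction and `β` follow the same
rule. -/
theorem beta_faceToPerm {a : MonoidAlgebra ℚ (SignVec (n + 1))} (ha : a ∈ faceInv (n + 1)) :
    faceRestrict n a ∈ faceInv n ∧
      (beta n ⟨faceToPerm (n + 1) a, faceToPerm_mem ha⟩ : MonoidAlgebra ℚ (SignedPerm n)) =
        faceToPerm n (faceRestrict n a) := by
  induction ha using Submodule.span_induction with
  | mem x hx =>
    obtain ⟨J, rfl⟩ := hx
    have hsub : J ∩ range (n + 1) ⊆ range (n + 1) := inter_subset_right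
    have e : (⟨faceToPerm (n + 1) (orbitSum (n + 1) J), faceToPerm_mem (orbitSum_mem J)⟩ :
        descentB (n + 1)) = xElem (n + 1) (J ∩ range (n + 1)) := by
      apply Subtype.ext
      exact (congrArg _ (orbitSum_inter J).symm).trans (faceToPerm_orbitSum _)
    refine ⟨?_, ?_⟩
    · rw [← orbitSum_inter, faceRestrict_orbitSum hsub]
      split_ifs
      · exact Submodule.zero_mem _
      · exact orbitSum_mem _
    · rw [e, beta_xElem n hsub, ← orbitSum_inter, faceRestrict_orbitSum hsub]
      split_ifs
      · simp
      · rw [faceToPerm_orbitSum]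
        rfl
  | zero =>
    refine ⟨by simp, ?_⟩
    have e : (⟨faceToPerm (n + 1) 0, faceToPerm_mem (Submodule.zero_mem _)⟩ :
        descentB (n + 1)) = 0 := Subtype.ext (map_zero _)
    rw [e]
    simp
  | add x y hx hy h1 h2 =>
    refine ⟨by rw [map_add]; exact Submodule.add_mem _ h1.1 h2.1, ?_⟩
    have e : (⟨faceToPerm (n + 1) (x + y), faceToPerm_mem (Submodule.add_mem _ hx hy)⟩ :
        descentB (n + 1)) = ⟨_, faceToPerm_mem hx⟩ + ⟨_, faceToPerm_mem hy⟩ :=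
      Subtype.ext (map_add _ _ _)
    rw [e, map_add, Submodule.coe_add, h1.2, h2.2, map_add, map_add]
  | smul c x hx h =>
    refine ⟨by rw [map_smul]; exact Submodule.smul_mem _ _ h.1, ?_⟩
    have e : (⟨faceToPerm (n + 1) (c • x), faceToPerm_mem (Submodule.smul_mem _ _ hx)⟩ :
        descentB (n + 1)) = c • ⟨_, faceToPerm_mem hx⟩ :=
      Subtype.ext (map_smul _ _ _)
    rw [e, map_smul, Submodule.coe_smul, h.2, map_smul, map_smul]

theorem beta_eq {a : MonoidAlgebra ℚ (SignVec (n + 1))} (ha : a ∈ faceInv (n + 1))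
    {x : descentB (n + 1)} (hx : faceToPerm (n + 1) a = x) :
    (beta n x : MonoidAlgebra ℚ (SignedPerm n)) = faceToPerm n (faceRestrict n a) := by
  obtain ⟨x, _⟩ := x
  subst hx
  exact (beta_faceToPerm ha).2

/-- Products are reversed on lifting to faces and again on returning, so multiplicativity of the
restriction passes to `β`. -/
theorem isAlgMorphism_beta (n : ℕ) : IsAlgMorphism (beta n) where
  source := isSubalgebra_descentB _
  target := isSubalgebra_descentB _
  map_one := by
    have h1 : (1 : MonoidAlgebra ℚ (SignVec (n + 1))) ∈ faceInv (n + 1) :=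
      orbitSum_empty (n := n + 1) ▸ orbitSum_mem _
    rw [beta_eq h1 faceToPerm_one, map_one, faceToPerm_one]
  map_mul := by
    rintro ⟨x, hx⟩ ⟨y, hy⟩
    obtain ⟨a, ha, rfl⟩ := exists_faceToPerm_eq hx
    obtain ⟨b, hb, rfl⟩ := exists_faceToPerm_eq hy
    rw [beta_eq (faceInv_mul_mem hb ha) (faceToPerm_mul hb ha), map_mul,
      faceToPerm_mul (beta_faceToPerm hb).1 (beta_faceToPerm ha).1, beta_eq ha rfl, beta_eq hb rfl]

theorem isAlgMorphism_betaSq (n : ℕ) : IsAlgMorphism (betaSq n) where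
  source := isSubalgebra_descentB _
  target := isSubalgebra_descentB _
  map_one := by
    have h1 := Subtype.ext (a2 := (⟨1, (isSubalgebra_descentB (n + 1)).one_mem⟩ : descentB (n + 1)))
      (isAlgMorphism_beta (n + 1)).map_one
    rw [betaSq, LinearMap.comp_apply, h1]
    exact (isAlgMorphism_beta n).map_one
  map_mul x y := by
    have h1 := Subtype.ext (a2 := (⟨beta (n + 1) x * beta (n + 1) y,
      (isSubalgebra_descentB (n + 1)).mul_mem _ (beta (n + 1) x).2 _ (beta (n + 1) y).2⟩ :
        descentB (n + 1))) ((isAlgMorphism_beta (n + 1)).map_mul x y)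
    rw [betaSq, LinearMap.comp_apply, h1]
    exact (isAlgMorphism_beta n).map_mul _ _

end Restriction

/-! ### Forgetting signs on descent classes -/

section Signings

variable {n : ℕ}

theorem entryA_succ (σ : Equiv.Perm (Fin n)) {i : ℕ} (hi : i < n) :
    entryA σ (i + 1) = (σ ⟨i, hi⟩ : ℕ) + 1 := by
  simp [entryA, hi]

theorem entryA_ne (σ : Equiv.Perm (Fin n)) {i : ℕ} (hi : i < n) :
    entryA σ i ≠ entryA σ (i + 1) := by
  rcases i with _ | i
  · rw [entryA_succ σ hi]
    simp [entryA]
  · have hi' : i < n := by omega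
    rw [entryA_succ σ hi, entryA_succ σ hi']
    intro h
    have h2 := σ.injective (Fin.ext (Nat.succ_injective h))
    simp [Fin.ext_iff] at h2

/-- The entries of `σ` ascend at `i`, where an infinite entry is appended at the end. -/
def IsUp (σ : Equiv.Perm (Fin n)) (i : ℕ) : Prop := i < n → entryA σ i < entryA σ (i + 1)

/-- The signs of the `i`-th entry that are compatible with the descent set `J`. -/
def signChoices (σ : Equiv.Perm (Fin n)) (J : Finset ℕ) (i : ℕ) : Finset ℤˣ :=
  open Classical in univ.filter fun s =>
    (IsUp σ i → (i ∈ J ↔ s = -1)) ∧ (¬ IsUp σ (i + 1) → (i + 1 ∈ J ↔ s = 1))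

/-- The signed permutation with the signs `s` in the places `1, …, n`. -/
def signing (σ : Equiv.Perm (Fin n)) (s : Fin n → ℤˣ) : SignedPerm n := ⟨fun j => s (σ⁻¹ j), σ⟩

theorem entryB_signing (σ : Equiv.Perm (Fin n)) (s : Fin n → ℤˣ) {i : ℕ} (hi : i < n) :
    entryB (signing σ s) (i + 1) = s ⟨i, hi⟩ * entryA σ (i + 1) := by
  simp [entryB, entryA, hi, signing]

/-- A descent between two neighbours depends on the sign of the one with larger absolute value: a
larger right entry must be negative, a larger left entry positive. So the conditions separate into
one per entry. -/
theorem desB_signing_eq_iff (σ : Equiv.Perm (Fin n)) (s : Fin n → ℤˣ) {J : Finset ℕ}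
    (hJ : J ⊆ range n) :
    desB (signing σ s) = J ↔ ∀ i : Fin n, s i ∈ signChoices σ J i := by
  have h0 : ∀ (h : 0 < n), entryB (signing σ s) 1 < entryB (signing σ s) 0 ↔ s ⟨0, h⟩ = -1 := by
    intro h
    rw [entryB_signing σ s h, entryA_succ σ h]
    rcases Int.units_eq_one_or (s ⟨0, h⟩) with e | e <;> rw [e] <;> simp [entryB] <;> omega
  have h1 : ∀ i (h : i + 1 < n), entryB (signing σ s) (i + 2) < entryB (signing σ s) (i + 1) ↔
      (IsUp σ (i + 1) ∧ s ⟨i + 1, h⟩ = -1 ∨ ¬ IsUp σ (i + 1) ∧ s ⟨i, by omega⟩ = 1) := by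
    intro i h
    have hu : IsUp σ (i + 1) ↔ entryA σ (i + 1) < entryA σ (i + 2) := by simp [IsUp, h]
    have hne : entryA σ (i + 1) ≠ entryA σ (i + 2) := entryA_ne σ h
    have hp : 0 < entryA σ (i + 1) := by rw [entryA_succ σ (show i < n by omega)]; omega
    have hp' : 0 < entryA σ (i + 2) := by rw [entryA_succ σ h]; omega
    have e2 : entryB (signing σ s) (i + 2) = s ⟨i + 1, h⟩ * entryA σ (i + 2) :=
      entryB_signing σ s h
    rw [hu, e2, entryB_signing σ s (show i < n by omega)]
    rcases Int.units_eq_one_or (s ⟨i + 1, h⟩) with e | e <;>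
    rcases Int.units_eq_one_or (s ⟨i, by omega⟩) with e' | e' <;> rw [e, e'] <;> simp <;> omega
  have hup : IsUp σ 0 := fun h => by rw [entryA_succ σ h]; simp [entryA]
  have hlast : ∀ i, n ≤ i → IsUp σ i := fun i hi h => absurd h (by omega)
  have hs : ∀ i : Fin n, s i = -1 ↔ ¬ s i = 1 := by
    intro i
    rcases Int.units_eq_one_or (s i) with e | e <;> rw [e] <;> decide
  have hd : desB (signing σ s) = J ↔ ∀ i < n,
      (entryB (signing σ s) (i + 1) < entryB (signing σ s) i ↔ i ∈ J) := by
    rw [Finset.ext_iff]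
    simp only [desB, mem_filter, mem_range]
    constructor
    · intro h i hi
      rw [← h]; simp [hi]
    · intro h i
      constructor
      · rintro ⟨a, b⟩; exact (h i a).1 b
      · intro hi
        have := mem_range.1 (hJ hi)
        exact ⟨this, (h i this).2 hi⟩
  rw [hd]
  simp only [signChoices, mem_filter, mem_univ, true_and]
  constructor
  · intro h i
    refine ⟨fun hu => ?_, fun hu => ?_⟩
    · obtain ⟨i, hi⟩ := i
      rw [← h i hi]
      rcases i with _ | i
      · exact h0 hi
      · rw [h1 i hi]; simp at hu; tauto
    · have hi : (i : ℕ) + 1 < n := by by_contra hc; exact hu (hlast _ (by omega))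
      rw [← h _ hi, h1 _ hi]
      tauto
  · intro h i hi
    rcases i with _ | i
    · rw [h0 hi]
      exact ((h ⟨0, hi⟩).1 hup).symm
    · rw [h1 i hi]
      have a := (h ⟨i + 1, hi⟩).1
      have b := (h ⟨i, by omega⟩).2
      simp only at a b
      tauto

/-- The positions in `{1, …, n - 1}` where membership in `J` changes. -/
def varSet (n : ℕ) (J : Finset ℕ) : Finset ℕ :=
  (Icc 1 (n - 1)).filter fun i => ¬ (i - 1 ∈ J ↔ i ∈ J)

theorem mem_peak_succ_iff (σ : Equiv.Perm (Fin n)) {i : ℕ} (hi : i < n) :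
    i + 1 ∈ peak σ ↔ IsUp σ i ∧ ¬ IsUp σ (i + 1) := by
  simp only [peak, mem_filter, mem_Icc, IsUp, hi, Nat.add_sub_cancel]
  constructor
  · rintro ⟨h1, h2, h3⟩
    exact ⟨fun _ => h2, fun h => by have := h (by omega); omega⟩
  · rintro ⟨h1, h2⟩
    push Not at h2
    have := entryA_ne σ h2.1
    exact ⟨by omega, h1 trivial, by omega⟩

/-- A peak is constrained twice, a valley not at all, every other entry once. The factors `1` and
`2` attached to ascents and descents are there to telescope: they move the two choices at a valley
over to a peak. -/
theorem card_signChoices (σ : Equiv.Perm (Fin n)) (J : Finset ℕ) {i : ℕ} (hi : i < n) :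
    open Classical in
    #(signChoices σ J i) * (if IsUp σ (i + 1) then 1 else 2) =
      (if i + 1 ∈ peak σ then (if i + 1 ∈ varSet n J then 2 else 0) else 1) *
        (if IsUp σ i then 1 else 2) := by
  classical
  have hu : (univ : Finset ℤˣ) = {1, -1} := rfl
  have hne : ¬ (-1 : ℤˣ) = 1 := by decide
  have hne' : ¬ (1 : ℤˣ) = -1 := by decide
  rw [if_congr (mem_peak_succ_iff σ hi) rfl rfl, signChoices, hu]
  by_cases h1 : IsUp σ i <;> by_cases h2 : IsUp σ (i + 1) <;> by_cases h3 : i ∈ J <;>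
    by_cases h4 : i + 1 ∈ J
  all_goals try simp [h1, h2, h3, h4, hne, hne', filter_insert, filter_singleton]
  all_goals
    have hlt : i + 1 < n := by by_contra hc; exact h2 fun h => absurd h hc
    have hv : i + 1 ∈ varSet n J ↔ ¬ (i ∈ J ↔ i + 1 ∈ J) := by
      simp only [varSet, mem_filter, mem_Icc, Nat.add_sub_cancel, and_iff_right_iff_imp]
      intro _; omega
    simp [hv, h3, h4]

theorem prod_card_signChoices (σ : Equiv.Perm (Fin n)) (J : Finset ℕ) :
    ∏ i : Fin n, #(signChoices σ J i) =
      if peak σ ⊆ varSet n J then 2 ^ #(peak σ) else 0 := by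
  classical
  set t : ℕ → ℕ := fun i => if IsUp σ i then 1 else 2 with ht
  have ht0 : t 0 = 1 := if_pos fun h => by rw [entryA_succ σ h]; simp [entryA]
  have htn : t n = 1 := if_pos fun h => absurd h (lt_irrefl _)
  -- The word starts with an ascent from `0` and ends with one to the appended infinite entry, so
  -- both boundary factors are `1`.
  have htt : ∏ i ∈ range n, t (i + 1) = ∏ i ∈ range n, t i := by
    have h1 := prod_range_succ t n
    have h2 := prod_range_succ' t n
    rw [ht0, mul_one] at h2
    rw [htn, mul_one] at h1
    rw [← h1, ← h2]
  have hpos : 0 < ∏ i ∈ range n, t i := prod_pos fun i _ => by simp only [ht]; split_ifs <;> omega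
  set c : ℕ → ℕ := fun i => if i ∈ varSet n J then 2 else 0 with hc
  have h1 : ∏ i ∈ range n, #(signChoices σ J i) =
      ∏ i ∈ range n, (if i + 1 ∈ peak σ then c (i + 1) else 1) := by
    apply Nat.eq_of_mul_eq_mul_right hpos
    conv_lhs => rw [← htt]
    rw [← prod_mul_distrib, ← prod_mul_distrib]
    exact prod_congr rfl fun i hi => card_signChoices σ J (mem_range.1 hi)
  have h2 : ∏ i ∈ range n, (if i + 1 ∈ peak σ then c (i + 1) else 1) = ∏ i ∈ peak σ, c i := by
    rw [← prod_filter]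
    refine prod_bij (fun i _ => i + 1) (fun i hi => (mem_filter.1 hi).2)
      (fun i _ j _ h => Nat.succ_injective h) (fun i hi => ?_) (fun _ _ => rfl)
    have := mem_Icc.1 (mem_filter.1 hi).1
    exact ⟨i - 1, mem_filter.2 ⟨mem_range.2 (by omega), by rwa [Nat.sub_add_cancel this.1]⟩,
      Nat.sub_add_cancel this.1⟩
  rw [Fin.prod_univ_eq_prod_range (fun i => #(signChoices σ J i)) n, h1, h2]
  split_ifs with h
  · rw [prod_congr rfl fun i hi => if_pos (h hi), prod_const]
  · obtain ⟨i, hi, hi'⟩ := not_subset.1 h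
    exact prod_eq_zero hi (if_neg hi')

theorem card_signings (σ : Equiv.Perm (Fin n)) {J : Finset ℕ} (hJ : J ⊆ range n) :
    #((univ : Finset (SignedPerm n)).filter fun w => desB w = J ∧ w.right = σ) =
      if peak σ ⊆ varSet n J then 2 ^ #(peak σ) else 0 := by
  rw [← prod_card_signChoices, ← Fintype.card_piFinset]
  symm
  refine card_bij (fun s _ => signing σ s) ?_ ?_ ?_
  · intro s hs
    exact mem_filter.2 ⟨mem_univ _, (desB_signing_eq_iff σ s hJ).2 (Fintype.mem_piFinset.1 hs), rfl⟩
  · intro s _ t _ h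
    have h1 := congrArg SemidirectProduct.left h
    ext i
    have := congrFun h1 (σ i)
    simp only [signing, Equiv.Perm.inv_def, Equiv.symm_apply_apply] at this
    rw [this]
  · intro w hw
    obtain ⟨-, h1, h2⟩ := mem_filter.1 hw
    have e : signing σ (fun i => w.left (σ i)) = w :=
      SemidirectProduct.ext (funext fun j => by simp [signing]) h2.symm
    exact ⟨_, Fintype.mem_piFinset.2 ((desB_signing_eq_iff σ _ hJ).1 (by rw [e, h1])), e⟩

theorem phi_single (w : SignedPerm n) (c : ℚ) :
    phi n (MonoidAlgebra.single w c) = MonoidAlgebra.single w.right c := by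
  rw [phi, MonoidAlgebra.mapDomainAlgHom_apply, MonoidAlgebra.mapDomain_single]
  rfl

/-! ### Coefficients in the peak algebra and surjectivity of `φ` -/

/-- The element of the peak algebra whose coefficient at `P_F` is `c F`. -/
def peakSum (n : ℕ) (c : Finset ℕ → ℚ) : peakAlg n := ∑ F ∈ fibSets n, c F • pElem n F

theorem coeff_peakSum (c : Finset ℕ → ℚ) (σ : Equiv.Perm (Fin n)) :
    (peakSum n c : MonoidAlgebra ℚ (Equiv.Perm (Fin n))).coeff σ = c (peak σ) := by
  simp only [peakSum, Submodule.coe_sum, Submodule.coe_smul, MonoidAlgebra.coeff_sum,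
    Finsupp.finsetSum_apply, MonoidAlgebra.coeff_smul, Finsupp.smul_apply, pElem, coeff_classSum]
  rw [sum_eq_single_of_mem _ (peak_mem σ) fun F _ h => by rw [if_neg h.symm, smul_zero]]
  simp

theorem exists_peakSum_eq (x : peakAlg n) : ∃ c, peakSum n c = x := by
  obtain ⟨x, hx⟩ := x
  have key : ∃ c, (peakSum n c : MonoidAlgebra ℚ (Equiv.Perm (Fin n))) = x := by
    unfold peakAlg classSpan at hx
    induction hx using Submodule.span_induction with
    | mem x hx =>
      obtain ⟨F, rfl⟩ := hx
      refine ⟨fun G => if G = F then 1 else 0, ?_⟩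
      ext σ
      rw [coeff_peakSum]
      exact (coeff_classSum _ _ _).symm
    | zero => exact ⟨0, by ext σ; rw [coeff_peakSum]; rfl⟩
    | add x y _ _ h1 h2 =>
      obtain ⟨c, rfl⟩ := h1
      obtain ⟨d, rfl⟩ := h2
      exact ⟨c + d, by ext σ; simp [coeff_peakSum]⟩
    | smul a x _ h =>
      obtain ⟨c, rfl⟩ := h
      exact ⟨a • c, by ext σ; simp [coeff_peakSum]⟩
  obtain ⟨c, hc⟩ := key
  exact ⟨c, Subtype.ext hc⟩

theorem peakSum_congr {c d : Finset ℕ → ℚ} (h : ∀ F ∈ fibSets n, c F = d F) :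
    peakSum n c = peakSum n d :=
  sum_congr rfl fun F hF => by rw [h F hF]

theorem eq_of_peakSum_eq {c d : Finset ℕ → ℚ} (h : peakSum n c = peakSum n d) {F : Finset ℕ}
    (hF : F ∈ fibSets n) : c F = d F := by
  obtain ⟨σ, rfl⟩ := exists_peak hF
  rw [← coeff_peakSum c, h, coeff_peakSum]

/-- The coefficient at `σ` counts the signings of `σ` with descent set `J`, which depends on `σ`
only through its peaks. -/
theorem phi_Y {J : Finset ℕ} (hJ : J ⊆ range n) :
    phi n (Y n J) = peakSum n fun F => if F ⊆ varSet n J then 2 ^ #F else 0 := by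
  ext σ
  rw [coeff_peakSum, Y, classSum, map_sum]
  simp only [MonoidAlgebra.of_apply, phi_single, MonoidAlgebra.coeff_sum, Finsupp.finsetSum_apply,
    MonoidAlgebra.coeff_single, Finsupp.single_apply]
  rw [← Finset.sum_filter, filter_filter, sum_const, card_signings σ hJ]
  split_ifs <;> simp

theorem phi_mem {x : MonoidAlgebra ℚ (SignedPerm n)} (hx : x ∈ descentB n) :
    phi n x ∈ peakAlg n := by
  have h : descentB n ≤ (peakAlg n).comap (phi n).toLinearMap := by
    unfold descentB classSpan
    rw [Submodule.span_le]
    rintro _ ⟨⟨J, hJ⟩, rfl⟩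
    have := phi_Y (mem_powerset.1 hJ)
    exact (congrArg (· ∈ peakAlg n) this).mpr (Subtype.prop _)
  exact h hx

/-- The restriction of `φ` to the descent algebra. -/
def phiDescent (n : ℕ) : descentB n →ₗ[ℚ] peakAlg n :=
  (phi n).toLinearMap.restrict fun _ hx => phi_mem hx

theorem coe_phiDescent (x : descentB n) :
    (phiDescent n x : MonoidAlgebra ℚ (Equiv.Perm (Fin n))) = phi n x := rfl

/-- Triangular inversion along inclusion with nonzero diagonal; it serves both the peak algebra and
the peak ideal. -/
theorem mem_of_triangular {M : Type*} [AddCommGroup M] [Module ℚ M] (S : Submodule ℚ M)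
    (s : Finset (Finset ℕ)) (v : Finset ℕ → M) (c : Finset ℕ → ℚ) (hc : ∀ F, c F ≠ 0)
    (h : ∀ F ∈ s, ∑ G ∈ s.filter (fun G => G ⊆ F), c G • v G ∈ S) :
    ∀ F ∈ s, v F ∈ S := by
  intro F
  induction F using Finset.strongInduction with
  | H F ih =>
    intro hF
    have h1 := h F hF
    have hm : F ∈ s.filter (fun G => G ⊆ F) := mem_filter.2 ⟨hF, Subset.refl F⟩
    rw [← Finset.add_sum_erase _ _ hm] at h1
    have h2 : ∑ G ∈ (s.filter fun G => G ⊆ F).erase F, c G • v G ∈ S := by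
      refine Submodule.sum_mem _ fun G hG => Submodule.smul_mem _ _ ?_
      obtain ⟨hne, hG⟩ := mem_erase.1 hG
      obtain ⟨hGs, hGF⟩ := mem_filter.1 hG
      exact ih G (hGF.ssubset_of_ne hne) hGs
    have h3 := (Submodule.add_mem_iff_left _ h2).1 h1
    exact (Submodule.smul_mem_iff _ (hc F)).1 h3

theorem exists_varSet_eq {D : Finset ℕ} (hD : D ⊆ Icc 1 (n - 1)) :
    ∃ J ⊆ range n, 0 ∉ J ∧ varSet n J = D := by
  -- Membership must toggle exactly at the elements of `D`, starting outside `J`: hence the parity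
  -- of the number of elements passed.
  refine ⟨(range n).filter fun i => Odd #(D.filter fun j => j ≤ i), filter_subset _ _, ?_, ?_⟩
  · have : (D.filter fun j => j ≤ 0) = ∅ := by
      refine filter_eq_empty_iff.2 fun j hj => ?_
      have := mem_Icc.1 (hD hj)
      omega
    simp only [mem_filter, mem_range, this]
    simp
  · ext i
    simp only [varSet, mem_filter, mem_range, mem_Icc]
    by_cases hi : 1 ≤ i ∧ i ≤ n - 1
    · have e : #(D.filter fun j => j ≤ i) =
          #(D.filter fun j => j ≤ i - 1) + if i ∈ D then 1 else 0 := by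
        have : (D.filter fun j => j ≤ i) =
            (D.filter fun j => j ≤ i - 1) ∪ (D.filter fun j => j = i) := by
          ext j
          simp only [mem_filter, mem_union, ← and_or_left]
          refine and_congr_right fun _ => ?_
          omega
        rw [this, card_union_of_disjoint, filter_eq']
        · split_ifs <;> simp
        · rw [disjoint_filter]
          intro j _ h1 h2
          omega
      have h1 : i < n := by omega
      have h2 : i - 1 < n := by omega
      rw [e]
      by_cases hiD : i ∈ D
      · simp only [hi, h1, h2, hiD, true_and, if_true, iff_true, Nat.odd_add_one, true_and]
        tauto
      · simp [hi, h1, h2, hiD]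
    · simp only [hi, false_and, false_iff]
      exact fun h => hi (mem_Icc.1 (hD h))

/-- `Y_J` as an element of the descent algebra. -/
def yElem (n : ℕ) (J : Finset ℕ) : descentB n := ⟨Y n J, classSum_mem _ _ desB_mem J⟩

theorem phiDescent_yElem {J : Finset ℕ} (hJ : J ⊆ range n) :
    phiDescent n (yElem n J) = peakSum n fun F => if F ⊆ varSet n J then 2 ^ #F else 0 :=
  Subtype.ext (phi_Y hJ)

theorem phiDescent_surjective (n : ℕ) : Function.Surjective (phiDescent n) := by
  have key : ∀ F ∈ fibSets n, pElem n F ∈ LinearMap.range (phiDescent n) := by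
    refine mem_of_triangular _ _ _ (fun F => 2 ^ #F) (fun F => by positivity) fun F hF => ?_
    obtain ⟨J, hJ, -, hD⟩ := exists_varSet_eq (mem_powerset.1 (mem_filter.1 hF).1)
    refine ⟨yElem n J, ?_⟩
    rw [phiDescent_yElem hJ, hD, peakSum, sum_filter]
    refine sum_congr rfl fun G _ => ?_
    split_ifs <;> simp
  intro x
  obtain ⟨c, rfl⟩ := exists_peakSum_eq x
  exact Submodule.sum_mem _ fun F hF => Submodule.smul_mem _ _ (key F hF)

/-- The peak algebra is the image of `Σ(B_n)` under the algebra morphism `φ`. -/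
theorem isSubalgebra_peakAlg (n : ℕ) : IsSubalgebra (peakAlg n) where
  one_mem := by
    rw [← map_one (phi n)]
    exact phi_mem (isSubalgebra_descentB n).one_mem
  mul_mem x hx y hy := by
    obtain ⟨a, ha⟩ := phiDescent_surjective n ⟨x, hx⟩
    obtain ⟨b, hb⟩ := phiDescent_surjective n ⟨y, hy⟩
    have ha := congrArg Subtype.val ha
    have hb := congrArg Subtype.val hb
    simp only [coe_phiDescent] at ha hb
    rw [← ha, ← hb, ← map_mul]
    exact phi_mem ((isSubalgebra_descentB n).mul_mem _ a.2 _ b.2)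

theorem isAlgMorphism_phiDescent (n : ℕ) : IsAlgMorphism (phiDescent n) where
  source := isSubalgebra_descentB n
  target := isSubalgebra_peakAlg n
  map_one := map_one (phi n)
  map_mul _ _ := map_mul (phi n) _ _

end Signings

section Kernels

variable {n : ℕ}

/-! ### The map `β` on the basis of descent classes -/

/-- The set `(J ∖ {0}) - 1`, as a subset of `{0, …, n - 1}`. -/
def shiftDown (n : ℕ) (J : Finset ℕ) : Finset ℕ := (range n).filter fun i => i + 1 ∈ J

theorem shiftDown_subset (J : Finset ℕ) : shiftDown n J ⊆ range n := filter_subset _ _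

theorem shiftDown_insert_zero (J : Finset ℕ) : shiftDown n (insert 0 J) = shiftDown n J := by
  simp [shiftDown]

theorem image_sub_one_eq {J : Finset ℕ} (hJ : J ⊆ range (n + 1)) (h0 : 0 ∉ J) :
    J.image (· - 1) = shiftDown n J := by
  ext i
  simp only [mem_image, shiftDown, mem_filter, mem_range]
  constructor
  · rintro ⟨j, hj, rfl⟩
    have h1 : j ≠ 0 := fun h => h0 (h ▸ hj)
    have := mem_range.1 (hJ hj)
    exact ⟨by omega, by rwa [Nat.sub_add_cancel (by omega)]⟩
  · rintro ⟨-, h⟩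
    exact ⟨i + 1, h, rfl⟩

theorem xElem_eq_sum {J : Finset ℕ} (hJ : J ⊆ range n) :
    xElem n J = ∑ I ∈ J.powerset, yElem n I := by
  apply Subtype.ext
  have e : (range n).powerset.filter (fun I => I ⊆ J) = J.powerset := by
    ext I
    simp only [mem_filter, mem_powerset, and_iff_right_iff_imp]
    exact fun h => h.trans hJ
  rw [Submodule.coe_sum, ← e]
  exact X_eq_sum n J

/-- Since `X_J` is the sum of the `Y_I` with `I ⊆ J`, it is enough that the proposed values have the
right sums over subsets. The sign makes `I` and `I ∪ {0}` cancel when `0 ∈ J`. -/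
theorem beta_yElem {J : Finset ℕ} (hJ : J ⊆ range (n + 1)) :
    beta n (yElem (n + 1) J) = (if 0 ∈ J then -1 else 1 : ℚ) • yElem n (shiftDown n J) := by
  set T : Finset ℕ → descentB n := fun J => (if 0 ∈ J then -1 else 1 : ℚ) • yElem n (shiftDown n J)
    with hT
  have hsum : ∀ J ⊆ range (n + 1), beta n (xElem (n + 1) J) = ∑ I ∈ J.powerset, T I := by
    intro J hJ
    rw [beta_xElem n hJ]
    split_ifs with h0
    · rw [← insert_erase h0, sum_powerset_insert (notMem_erase 0 J), ← sum_add_distrib]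
      symm
      refine sum_eq_zero fun I hI => ?_
      have hI0 : 0 ∉ I := fun h => notMem_erase 0 J (mem_powerset.1 hI h)
      simp only [hT]
      rw [shiftDown_insert_zero, if_neg hI0, if_pos (mem_insert_self 0 I), ← add_smul]
      simp
    · rw [image_sub_one_eq hJ h0, xElem_eq_sum (shiftDown_subset J)]
      symm
      refine sum_bij' (fun I _ => shiftDown n I) (fun K _ => K.image (· + 1)) ?_ ?_ ?_ ?_ ?_
      · intro I hI
        exact mem_powerset.2 (monotone_filter_right _ fun i _ h => mem_powerset.1 hI h)
      · intro K hK
        refine mem_powerset.2 fun i hi => ?_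
        obtain ⟨j, hj, rfl⟩ := mem_image.1 hi
        exact (mem_filter.1 (mem_powerset.1 hK hj)).2
      · intro I hI
        have hIJ := mem_powerset.1 hI
        ext i
        simp only [mem_image, shiftDown, mem_filter, mem_range]
        constructor
        · rintro ⟨j, ⟨-, h⟩, rfl⟩; exact h
        · intro h
          have h1 : i ≠ 0 := fun e => h0 (e ▸ hIJ h)
          have := mem_range.1 (hJ (hIJ h))
          exact ⟨i - 1, ⟨by omega, by rwa [Nat.sub_add_cancel (by omega)]⟩, by omega⟩
      · intro K hK
        ext i
        simp only [shiftDown, mem_filter, mem_range, mem_image, Nat.add_right_cancel_iff,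
          exists_eq_right, and_iff_right_iff_imp]
        exact fun h => mem_range.1 (mem_filter.1 (mem_powerset.1 hK h)).1
      · intro I hI
        have hI0 : 0 ∉ I := fun h => h0 (mem_powerset.1 hI h)
        simp [hT, hI0]
  -- The sums over all subsets determine the individual values, by removing the top term.
  induction J using Finset.strongInduction with
  | H J ih =>
    have h1 := hsum J hJ
    rw [xElem_eq_sum hJ, map_sum, ← add_sum_erase _ _ (mem_powerset_self J),
      ← add_sum_erase _ _ (mem_powerset_self J)] at h1
    rw [sum_congr rfl fun I hI => ?_] at h1
    · exact add_right_cancel h1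
    · obtain ⟨hne, hI⟩ := mem_erase.1 hI
      have hI := mem_powerset.1 hI
      exact ih I (hI.ssubset_of_ne hne) (hI.trans hJ)

theorem beta_surjective (n : ℕ) : Function.Surjective (beta n) := by
  have h : LinearMap.range (beta n) = ⊤ := by
    rw [← top_le_iff]
    refine (span_xElem n).trans ?_
    rw [Submodule.span_le]
    rintro _ ⟨⟨J, hJ⟩, rfl⟩
    have hJ := mem_powerset.1 hJ
    have hs : J.image (· + 1) ⊆ range (n + 1) := by
      intro i hi
      obtain ⟨j, hj, rfl⟩ := mem_image.1 hi
      have := mem_range.1 (hJ hj)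
      exact mem_range.2 (by omega)
    refine ⟨xElem (n + 1) (J.image (· + 1)), ?_⟩
    rw [beta_xElem n hs, if_neg (by simp)]
    congr 1
    simp [image_image, Function.comp_def]
  exact LinearMap.range_eq_top.1 h

theorem betaSq_surjective (n : ℕ) : Function.Surjective (betaSq n) :=
  (beta_surjective n).comp (beta_surjective (n + 1))

/-! ### The map `π` and its kernel -/

theorem mem_fibSets {F : Finset ℕ} :
    F ∈ fibSets n ↔ (∀ i ∈ F, 1 ≤ i ∧ i ≤ n - 1) ∧ ∀ i ∈ F, i + 1 ∉ F := by
  simp [fibSets, subset_iff]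

/-- The set `F + 2`. -/
def shiftUp (F : Finset ℕ) : Finset ℕ := F.image (· + 2)

theorem mem_shiftUp {F : Finset ℕ} {i : ℕ} : i ∈ shiftUp F ↔ 2 ≤ i ∧ i - 2 ∈ F := by
  simp only [shiftUp, mem_image]
  constructor
  · rintro ⟨j, hj, rfl⟩; exact ⟨by omega, by simpa using hj⟩
  · rintro ⟨h1, h2⟩; exact ⟨i - 2, h2, by omega⟩

theorem one_notMem_shiftUp (F : Finset ℕ) : 1 ∉ shiftUp F := by
  simp [mem_shiftUp]

theorem card_shiftUp (F : Finset ℕ) : #(shiftUp F) = #F :=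
  card_image_of_injective _ fun _ _ h => Nat.add_right_cancel h

theorem image_sub_two_shiftUp (F : Finset ℕ) : (shiftUp F).image (· - 2) = F := by
  simp [shiftUp, image_image, Function.comp_def]

theorem shiftUp_image_sub_two {F : Finset ℕ} (h : ∀ i ∈ F, 2 ≤ i) :
    shiftUp (F.image (· - 2)) = F := by
  rw [shiftUp, image_image]
  conv_rhs => rw [← image_id (s := F)]
  exact image_congr fun i hi => Nat.sub_add_cancel (h i hi)

theorem image_sub_two_mem_fibSets {F : Finset ℕ} (hF : F ∈ fibSets (n + 2))
    (h1 : 1 ∉ F) (h2 : 2 ∉ F) : F.image (· - 2) ∈ fibSets n := by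
  rw [mem_fibSets] at hF ⊢
  have h3 : ∀ i ∈ F, 3 ≤ i := by
    intro i hi
    have := hF.1 i hi
    by_contra hc
    have : i = 1 ∨ i = 2 := by omega
    rcases this with rfl | rfl <;> contradiction
  constructor
  · intro i hi
    obtain ⟨j, hj, rfl⟩ := mem_image.1 hi
    have := h3 j hj
    have := hF.1 j hj
    omega
  · intro i hi hi'
    obtain ⟨j, hj, rfl⟩ := mem_image.1 hi
    obtain ⟨k, hk, hk'⟩ := mem_image.1 hi'
    have := h3 j hj
    have := h3 k hk
    have e : k = j + 1 := by omega
    exact hF.2 j hj (e ▸ hk)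

theorem shiftUp_mem_fibSets {F : Finset ℕ} (hF : F ∈ fibSets n) : shiftUp F ∈ fibSets (n + 2) := by
  rw [mem_fibSets] at hF ⊢
  constructor
  · intro i hi
    rw [mem_shiftUp] at hi
    have := hF.1 _ hi.2
    omega
  · intro i hi hi'
    rw [mem_shiftUp] at hi hi'
    exact hF.2 _ hi.2 (by rw [show i - 2 + 1 = i + 1 - 2 by omega]; exact hi'.2)

theorem insert_one_mem_fibSets {F : Finset ℕ} (hF : F ∈ fibSets (n + 2)) (h2 : 2 ∉ F) :
    insert 1 F ∈ fibSets (n + 2) := by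
  rw [mem_fibSets] at hF ⊢
  constructor
  · intro i hi
    rcases mem_insert.1 hi with rfl | hi
    · omega
    · exact hF.1 i hi
  · intro i hi hi'
    rcases mem_insert.1 hi with rfl | hi <;> rcases mem_insert.1 hi' with h | h
    · omega
    · exact h2 h
    · have := hF.1 i hi; omega
    · exact hF.2 i hi h

theorem erase_mem_fibSets {F : Finset ℕ} (hF : F ∈ fibSets n) (i : ℕ) :
    F.erase i ∈ fibSets n := by
  rw [mem_fibSets] at hF ⊢
  exact ⟨fun j hj => hF.1 j (mem_of_mem_erase hj),
    fun j hj h => hF.2 j (mem_of_mem_erase hj) (mem_of_mem_erase h)⟩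

theorem two_notMem_shiftUp {F : Finset ℕ} (hF : F ∈ fibSets n) : 2 ∉ shiftUp F := by
  rw [mem_shiftUp]
  rintro ⟨-, h⟩
  have := (mem_fibSets.1 hF).1 _ h
  omega

theorem sum_sub_smul {ι M : Type*} [AddCommGroup M] [Module ℚ M] (s : Finset ι) (c d : ι → ℚ)
    (v : ι → M) : ∑ i ∈ s, (c i - d i) • v i = ∑ i ∈ s, c i • v i + ∑ i ∈ s, d i • -v i := by
  rw [← sum_add_distrib]
  exact sum_congr rfl fun i _ => by rw [sub_smul, smul_neg, sub_eq_add_neg]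

/-- Exactly two basis elements reach `P_G`: the one of `G + 2` with sign `+`, and the one of `{1} ∪
(G + 2)` with sign `-`. -/
theorem piMap_peakSum (c : Finset ℕ → ℚ) :
    piMap n (peakSum (n + 2) c) =
      peakSum n fun G => c (shiftUp G) - c (insert 1 (shiftUp G)) := by
  rw [peakSum, map_sum, ← sum_filter_add_sum_filter_not _ (fun F => 1 ∈ F), add_comm]
  refine Eq.trans ?_ (sum_sub_smul _ _ _ _).symm
  congr 1
  · rw [← sum_filter_add_sum_filter_not _ (fun F => 2 ∈ F), sum_eq_zero, zero_add]
    · refine sum_bij' (fun F _ => F.image (· - 2)) (fun G _ => shiftUp G) ?_ ?_ ?_ ?_ ?_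
      · intro F hF
        simp only [mem_filter] at hF
        exact image_sub_two_mem_fibSets hF.1.1 hF.1.2 hF.2
      · intro G hG
        simp only [mem_filter]
        exact ⟨⟨shiftUp_mem_fibSets hG, one_notMem_shiftUp G⟩, two_notMem_shiftUp hG⟩
      · intro F hF
        simp only [mem_filter] at hF
        refine shiftUp_image_sub_two fun i hi => ?_
        have := (mem_fibSets.1 hF.1.1).1 i hi
        have : i ≠ 1 := fun h => hF.1.2 (h ▸ hi)
        omega
      · exact fun G _ => image_sub_two_shiftUp G
      · intro F hF
        simp only [mem_filter] at hF
        rw [map_smul, piMap_pElem n hF.1.1, if_neg hF.1.2, if_neg hF.2,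
          shiftUp_image_sub_two]
        intro i hi
        have := (mem_fibSets.1 hF.1.1).1 i hi
        have : i ≠ 1 := fun h => hF.1.2 (h ▸ hi)
        omega
    · intro F hF
      simp only [mem_filter] at hF
      rw [map_smul, piMap_pElem n hF.1.1, if_neg hF.1.2, if_pos hF.2, smul_zero]
  · have h3 : ∀ F ∈ (fibSets (n + 2)).filter (fun F => 1 ∈ F),
        shiftUp ((F.erase 1).image (· - 2)) = F.erase 1 := by
      intro F hF
      refine shiftUp_image_sub_two fun i hi => ?_
      have := (mem_fibSets.1 (mem_filter.1 hF).1).1 i (mem_of_mem_erase hi)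
      have := ne_of_mem_erase hi
      omega
    refine sum_bij' (fun F _ => (F.erase 1).image (· - 2)) (fun G _ => insert 1 (shiftUp G))
      ?_ ?_ ?_ ?_ ?_
    · intro F hF
      obtain ⟨hF, h1⟩ := mem_filter.1 hF
      refine image_sub_two_mem_fibSets (erase_mem_fibSets hF 1) (notMem_erase 1 F) fun h => ?_
      exact (mem_fibSets.1 hF).2 1 h1 (mem_of_mem_erase h)
    · intro G hG
      exact mem_filter.2 ⟨insert_one_mem_fibSets (shiftUp_mem_fibSets hG) (two_notMem_shiftUp hG),
        mem_insert_self _ _⟩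
    · intro F hF
      rw [h3 F hF, insert_erase (mem_filter.1 hF).2]
    · intro G _
      rw [erase_insert (one_notMem_shiftUp G), image_sub_two_shiftUp]
    · intro F hF
      rw [h3 F hF, insert_erase (mem_filter.1 hF).2, map_smul,
        piMap_pElem n (mem_filter.1 hF).1, if_pos (mem_filter.1 hF).2]

theorem peakSum_mem_peakIdeal {c : Finset ℕ → ℚ}
    (h : ∀ F ∈ fibSets n, c F = c (F.erase 1)) :
    (peakSum n c : MonoidAlgebra ℚ (Equiv.Perm (Fin n))) ∈ peakIdeal n := by
  have e : (peakSum n c : MonoidAlgebra ℚ (Equiv.Perm (Fin n))) =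
      ∑ F ∈ intFibSets n, c F • classSum intPeak F := by
    ext σ
    rw [coeff_peakSum, h _ (peak_mem σ), ← intPeak_eq]
    simp only [MonoidAlgebra.coeff_sum, Finsupp.finsetSum_apply, MonoidAlgebra.coeff_smul,
      Finsupp.smul_apply, coeff_classSum]
    have hm : intPeak σ ∈ intFibSets n := by
      rw [intPeak_eq]
      exact mem_filter.2 ⟨erase_mem_fibSets (peak_mem σ) 1, notMem_erase _ _⟩
    rw [sum_eq_single_of_mem _ hm fun F _ h => by rw [if_neg h.symm, smul_zero]]
    simp
  rw [e]
  exact Submodule.sum_mem _ fun F hF => Submodule.smul_mem _ _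
    (Submodule.subset_span ⟨⟨F, hF⟩, rfl⟩)

theorem coeff_eq_of_mem_peakIdeal {x : MonoidAlgebra ℚ (Equiv.Perm (Fin n))}
    (hx : x ∈ peakIdeal n) {σ τ : Equiv.Perm (Fin n)} (h : intPeak σ = intPeak τ) :
    x.coeff σ = x.coeff τ := by
  unfold peakIdeal classSpan at hx
  induction hx using Submodule.span_induction with
  | mem x hx =>
    obtain ⟨F, rfl⟩ := hx
    simp only [coeff_classSum, h]
  | zero => rfl
  | add x y _ _ h1 h2 => simp [h1, h2]
  | smul a x _ h => simp [h]

/-- Interior peaks are the peaks other than `1`, so the ideal consists of the combinations whose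
coefficients ignore `1`. -/
theorem peakSum_mem_peakIdeal_iff {c : Finset ℕ → ℚ} :
    (peakSum n c : MonoidAlgebra ℚ (Equiv.Perm (Fin n))) ∈ peakIdeal n ↔
      ∀ F ∈ fibSets n, c F = c (F.erase 1) := by
  refine ⟨fun h F hF => ?_, peakSum_mem_peakIdeal⟩
  obtain ⟨σ, rfl⟩ := exists_peak hF
  obtain ⟨τ, hτ⟩ := exists_peak (erase_mem_fibSets hF 1)
  have := coeff_eq_of_mem_peakIdeal h (σ := σ) (τ := τ) (by
    rw [intPeak_eq, intPeak_eq, hτ, erase_idem])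
  rwa [coeff_peakSum, coeff_peakSum, hτ] at this

/-- The vanishing of each difference from `piMap_peakSum` says that the coefficients ignore `1`; a
set in `𝓕_{n+2}` containing `1` has the form `{1} ∪ (G + 2)`. -/
theorem piMap_eq_zero_iff (x : peakAlg (n + 2)) :
    piMap n x = 0 ↔ (x : MonoidAlgebra ℚ (Equiv.Perm (Fin (n + 2)))) ∈ peakIdeal (n + 2) := by
  obtain ⟨c, rfl⟩ := exists_peakSum_eq x
  have h0 : (0 : peakAlg n) = peakSum n fun _ => 0 := by simp [peakSum]
  rw [piMap_peakSum, peakSum_mem_peakIdeal_iff, h0]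
  constructor
  · intro h F hF
    by_cases h1 : 1 ∈ F
    · have h2 : 2 ∉ F.erase 1 := fun h => (mem_fibSets.1 hF).2 1 h1 (mem_of_mem_erase h)
      have := eq_of_peakSum_eq h
        (image_sub_two_mem_fibSets (erase_mem_fibSets hF 1) (notMem_erase 1 F) h2)
      rw [shiftUp_image_sub_two, insert_erase h1] at this
      · exact (sub_eq_zero.1 this).symm
      · intro i hi
        have := (mem_fibSets.1 hF).1 i (mem_of_mem_erase hi)
        have := ne_of_mem_erase hi
        omega
    · rw [erase_eq_of_notMem h1]
  · intro h
    refine peakSum_congr fun G hG => ?_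
    have := h _ (insert_one_mem_fibSets (shiftUp_mem_fibSets hG) (two_notMem_shiftUp hG))
    rw [erase_insert (one_notMem_shiftUp G)] at this
    rw [this, sub_self]

/-! ### The commutative square -/

theorem span_yElem (n : ℕ) : Submodule.span ℚ (yElem n '' {J | J ⊆ range n}) = ⊤ := by
  rw [← top_le_iff]
  refine (span_xElem n).trans ?_
  rw [Submodule.span_le]
  rintro _ ⟨⟨J, hJ⟩, rfl⟩
  have hJ := mem_powerset.1 hJ
  simp only [SetLike.mem_coe]
  rw [xElem_eq_sum hJ]
  exact Submodule.sum_mem _ fun I hI =>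
    Submodule.subset_span ⟨I, (mem_powerset.1 hI).trans hJ, rfl⟩

theorem shiftUp_subset_varSet_iff {F J : Finset ℕ} (hF : F ∈ fibSets n) :
    shiftUp F ⊆ varSet (n + 2) J ↔ F ⊆ varSet n (shiftDown n (shiftDown (n + 1) J)) := by
  have key : ∀ i ∈ F, i + 2 ∈ varSet (n + 2) J ↔
      i ∈ varSet n (shiftDown n (shiftDown (n + 1) J)) := by
    intro i hi
    have hb := (mem_fibSets.1 hF).1 i hi
    obtain ⟨i, rfl⟩ : ∃ j, i = j + 1 := ⟨i - 1, by omega⟩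
    have a1 : i < n := by omega
    have a2 : i + 1 < n := by omega
    have a3 : i + 1 + 1 < n + 1 := by omega
    have a4 : i + 1 < n + 1 := by omega
    simp only [varSet, shiftDown, mem_filter, mem_Icc, mem_range, Nat.add_sub_cancel,
      show i + 1 + 2 - 1 = i + 1 + 1 by omega, a1, a2, a3, a4, true_and]
    constructor
    · rintro ⟨-, h⟩; exact ⟨by omega, h⟩
    · rintro ⟨-, h⟩; exact ⟨by omega, h⟩
  constructor
  · intro h i hi
    exact (key i hi).1 (h (mem_shiftUp.2 ⟨by omega, by simpa using hi⟩))
  · intro h i hi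
    obtain ⟨h1, h2⟩ := mem_shiftUp.1 hi
    have := (key _ h2).2 (h h2)
    rwa [Nat.sub_add_cancel h1] at this

theorem betaSq_yElem {J : Finset ℕ} (hJ : J ⊆ range (n + 2)) :
    betaSq n (yElem (n + 2) J) = (if 0 ∈ J ↔ 1 ∈ J then 1 else -1 : ℚ) •
      yElem n (shiftDown n (shiftDown (n + 1) J)) := by
  have h2 : 0 ∈ shiftDown (n + 1) J ↔ 1 ∈ J := by
    simp [shiftDown]
  rw [betaSq, LinearMap.comp_apply, beta_yElem hJ, map_smul, beta_yElem (shiftDown_subset _),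
    smul_smul, if_congr h2 rfl rfl]
  congr 1
  by_cases h4 : 0 ∈ J <;> by_cases h5 : 1 ∈ J <;> simp [h4, h5]

theorem smul_peakSum (a : ℚ) (c : Finset ℕ → ℚ) :
    a • peakSum n c = peakSum n fun F => a * c F := by
  rw [peakSum, smul_sum]
  exact sum_congr rfl fun F _ => smul_smul _ _ _

/-- The sign is `-1` exactly when membership in `J` changes at `1`. Then both terms on the right are
present or both absent, and `2^k - 2^(k+1) = -2^k`; otherwise the last term is absent. -/
theorem varSet_weights {J F : Finset ℕ} (hF : F ∈ fibSets n) :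
    (if 0 ∈ J ↔ 1 ∈ J then 1 else -1 : ℚ) *
      (if F ⊆ varSet n (shiftDown n (shiftDown (n + 1) J)) then 2 ^ #F else 0) =
    (if shiftUp F ⊆ varSet (n + 2) J then 2 ^ #(shiftUp F) else 0) -
      if insert 1 (shiftUp F) ⊆ varSet (n + 2) J then 2 ^ #(insert 1 (shiftUp F)) else 0 := by
  have h1 : 1 ∈ varSet (n + 2) J ↔ ¬ (0 ∈ J ↔ 1 ∈ J) := by
    simp [varSet]
  have h3 := shiftUp_subset_varSet_iff (J := J) hF
  have h4 : insert 1 (shiftUp F) ⊆ varSet (n + 2) J ↔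
      ¬ (0 ∈ J ↔ 1 ∈ J) ∧ F ⊆ varSet n (shiftDown n (shiftDown (n + 1) J)) := by
    rw [insert_subset_iff, h1, h3]
  rw [card_insert_of_notMem (one_notMem_shiftUp F), card_shiftUp, if_congr h3 rfl rfl,
    if_congr h4 rfl rfl]
  by_cases h5 : F ⊆ varSet n (shiftDown n (shiftDown (n + 1) J))
  · by_cases h6 : 0 ∈ J ↔ 1 ∈ J
    · simp [h5, h6]
    · simp only [h5, h6, if_true, if_false, not_false_eq_true, and_self]
      ring
  · simp [h5]

theorem phiDescent_betaSq (n : ℕ) :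
    phiDescent n ∘ₗ betaSq n = piMap n ∘ₗ phiDescent (n + 2) := by
  have key : ∀ J, J ⊆ range (n + 2) → phiDescent n (betaSq n (yElem (n + 2) J)) =
      piMap n (phiDescent (n + 2) (yElem (n + 2) J)) := by
    intro J hJ
    rw [betaSq_yElem hJ, map_smul, phiDescent_yElem (shiftDown_subset _), smul_peakSum,
      phiDescent_yElem hJ, piMap_peakSum]
    exact peakSum_congr fun F hF => varSet_weights hF
  refine LinearMap.ext_on (span_yElem (n + 2)) ?_
  rintro _ ⟨J, hJ, rfl⟩
  exact key J hJ

theorem piMap_surjective (n : ℕ) : Function.Surjective (piMap n) := by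
  have h : Function.Surjective (phiDescent n ∘ₗ betaSq n) :=
    (phiDescent_surjective n).comp (betaSq_surjective n)
  rw [phiDescent_betaSq] at h
  exact Function.Surjective.of_comp h

/-- Elements of the peak algebra lift along `φ`, so the unit and products are computed in the
descent algebra and carried over by the square. -/
theorem isAlgMorphism_piMap (n : ℕ) : IsAlgMorphism (piMap n) where
  source := isSubalgebra_peakAlg _
  target := isSubalgebra_peakAlg _
  map_one := by
    have h := LinearMap.congr_fun (phiDescent_betaSq n) ⟨1, (isSubalgebra_descentB _).one_mem⟩
    rw [LinearMap.comp_apply, LinearMap.comp_apply] at h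
    have h1 : phiDescent (n + 2) ⟨1, (isSubalgebra_descentB _).one_mem⟩ =
        ⟨1, (isSubalgebra_peakAlg _).one_mem⟩ :=
      Subtype.ext (isAlgMorphism_phiDescent (n + 2)).map_one
    rw [← h1, ← h, coe_phiDescent, (isAlgMorphism_betaSq n).map_one, map_one]
  map_mul x y := by
    obtain ⟨a, rfl⟩ := phiDescent_surjective _ x
    obtain ⟨b, rfl⟩ := phiDescent_surjective _ y
    have h := LinearMap.congr_fun (phiDescent_betaSq n)
    simp only [LinearMap.comp_apply] at h
    have h1 : phiDescent (n + 2) ⟨a * b, (isSubalgebra_descentB _).mul_mem _ a.2 _ b.2⟩ =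
        ⟨phiDescent (n + 2) a * phiDescent (n + 2) b,
          (isSubalgebra_peakAlg _).mul_mem _ (Subtype.prop _) _ (Subtype.prop _)⟩ :=
      Subtype.ext ((isAlgMorphism_phiDescent (n + 2)).map_mul a b)
    rw [← h1, ← h, ← h, ← h, coe_phiDescent, (isAlgMorphism_betaSq n).map_mul, map_mul]
    rfl

/-! ### Kernels as ideals -/

theorem isIdealOf_ker {A B : Type*} [Ring A] [Algebra ℚ A] [Ring B] [Algebra ℚ B]
    {S : Submodule ℚ A} {T : Submodule ℚ B} {f : S →ₗ[ℚ] T} (hf : IsAlgMorphism f) :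
    IsIdealOf ((LinearMap.ker f).map S.subtype) S where
  le := Submodule.map_subtype_le _ _
  mul_mem_left := by
    rintro a ha _ ⟨x, hx, rfl⟩
    refine ⟨⟨a * x, hf.source.mul_mem _ ha _ x.2⟩, ?_, rfl⟩
    have hx : f x = 0 := hx
    refine Subtype.ext ((hf.map_mul ⟨a, ha⟩ x).trans ?_)
    rw [hx]
    simp
  mul_mem_right := by
    rintro _ ⟨x, hx, rfl⟩ a ha
    refine ⟨⟨x * a, hf.source.mul_mem _ x.2 _ ha⟩, ?_, rfl⟩
    have hx : f x = 0 := hx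
    refine Subtype.ext ((hf.map_mul x ⟨a, ha⟩).trans ?_)
    rw [hx]
    simp

theorem map_ker_piMap (n : ℕ) :
    (LinearMap.ker (piMap n)).map (peakAlg (n + 2)).subtype = peakIdeal (n + 2) := by
  ext x
  constructor
  · rintro ⟨x, hx, rfl⟩
    exact (piMap_eq_zero_iff x).1 hx
  · intro hx
    exact ⟨⟨x, peakIdeal_le _ hx⟩, (piMap_eq_zero_iff _).2 hx, rfl⟩

theorem mem_idealB_iff (x : descentB (n + 2)) :
    (x : MonoidAlgebra ℚ (SignedPerm (n + 2))) ∈ idealB n ↔ betaSq n x = 0 := by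
  rw [idealB]
  constructor
  · rintro ⟨y, hy, h⟩
    rwa [← Subtype.ext h]
  · intro h
    exact ⟨x, h, rfl⟩

/-! ### The restriction of `φ` to the ideals -/

theorem phi_mem_peakIdeal {x : MonoidAlgebra ℚ (SignedPerm (n + 2))} (hx : x ∈ idealB n) :
    phi (n + 2) x ∈ peakIdeal (n + 2) := by
  obtain ⟨x, hx, rfl⟩ := hx
  have hx : betaSq n x = 0 := hx
  have h := LinearMap.congr_fun (phiDescent_betaSq n) x
  rw [LinearMap.comp_apply, LinearMap.comp_apply, hx, map_zero] at h
  exact (piMap_eq_zero_iff _).1 h.symm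

/-- The restriction of `φ` to `I^{0,1}`. -/
def phiIdeal (n : ℕ) : idealB n →ₗ[ℚ] peakIdeal (n + 2) :=
  (phi (n + 2)).toLinearMap.restrict fun _ hx => phi_mem_peakIdeal hx

/-- A single `β` already kills this sum: both terms have the same shift and opposite signs. -/
theorem yElem_add_mem_idealB {J : Finset ℕ} (hJ : J ⊆ range (n + 2)) (h0 : 0 ∉ J) :
    Y (n + 2) J + Y (n + 2) (insert 0 J) ∈ idealB n := by
  have hJ' : insert 0 J ⊆ range (n + 2) := insert_subset (by simp) hJ
  have h := mem_idealB_iff (yElem (n + 2) J + yElem (n + 2) (insert 0 J))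
  refine h.2 ?_
  rw [betaSq, LinearMap.comp_apply, map_add, beta_yElem hJ, beta_yElem hJ', shiftDown_insert_zero,
    if_neg h0, if_pos (mem_insert_self 0 J), ← add_smul]
  simp

theorem varSet_insert_zero {J : Finset ℕ} (h0 : 0 ∉ J) (h1 : 1 ∉ varSet (n + 2) J) :
    varSet (n + 2) (insert 0 J) = insert 1 (varSet (n + 2) J) := by
  have h2 : 1 ∉ J := by simpa [varSet, h0] using h1
  ext i
  rcases i with _ | _ | i
  · simp [varSet]
  · simp [varSet, h2]
  · simp [varSet]

/-- Inserting `0` into `J` adds `1` to the set of changes. If `1` is a peak of `σ`, only the second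
term contributes, with one extra factor `2`; if not, both contribute equally. Either way the weight
is `2^(k+1)` for `k` interior peaks. -/
theorem phi_yElem_add {J : Finset ℕ} (hJ : J ⊆ range (n + 2)) (h0 : 0 ∉ J)
    (h1 : 1 ∉ varSet (n + 2) J) :
    phi (n + 2) (Y (n + 2) J + Y (n + 2) (insert 0 J)) =
      ∑ F ∈ (intFibSets (n + 2)).filter (fun F => F ⊆ varSet (n + 2) J),
        (2 ^ (#F + 1) : ℚ) • classSum intPeak F := by
  have hJ' : insert 0 J ⊆ range (n + 2) := insert_subset (by simp) hJ
  rw [map_add, phi_Y hJ, phi_Y hJ', varSet_insert_zero h0 h1]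
  ext σ
  rw [MonoidAlgebra.coeff_add, Finsupp.add_apply, coeff_peakSum, coeff_peakSum, sum_filter]
  simp only [MonoidAlgebra.coeff_sum, Finsupp.finsetSum_apply]
  have hm : intPeak σ ∈ intFibSets (n + 2) := by
    rw [intPeak_eq]
    exact mem_filter.2 ⟨erase_mem_fibSets (peak_mem σ) 1, notMem_erase _ _⟩
  rw [sum_eq_single_of_mem _ hm]
  · have e : (intPeak σ ⊆ varSet (n + 2) J) ↔ peak σ ⊆ insert 1 (varSet (n + 2) J) := by
      rw [intPeak_eq, subset_insert_iff]
    by_cases h2 : intPeak σ ⊆ varSet (n + 2) J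
    · rw [if_pos h2, if_pos (e.1 h2), MonoidAlgebra.coeff_smul, Finsupp.smul_apply,
        coeff_classSum, if_pos rfl, smul_eq_mul, mul_one, intPeak_eq]
      rw [intPeak_eq] at h2
      by_cases h3 : 1 ∈ peak σ
      · rw [if_neg fun h => h1 (h h3), zero_add, card_erase_add_one h3]
      · rw [erase_eq_of_notMem h3] at h2 ⊢
        rw [if_pos h2]
        ring
    · rw [if_neg h2, if_neg (mt e.2 h2), if_neg]
      · simp
      · exact fun h => h2 (e.2 (h.trans (subset_insert _ _)))
  · intro F _ hF
    split_ifs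
    · rw [MonoidAlgebra.coeff_smul, Finsupp.smul_apply, coeff_classSum, if_neg hF.symm, smul_zero]
    · rfl

theorem phiIdeal_surjective (n : ℕ) : Function.Surjective (phiIdeal n) := by
  have key : ∀ F ∈ intFibSets (n + 2),
      classSum intPeak F ∈ (idealB n).map (phi (n + 2)).toLinearMap := by
    refine mem_of_triangular _ _ _ (fun F => 2 ^ (#F + 1)) (fun F => by positivity) fun F hF => ?_
    obtain ⟨hF, h1⟩ := mem_filter.1 hF
    -- The choice `0 ∉ J` is what allows `J` to be paired with `J ∪ {0}`.
    obtain ⟨J, hJ, h0, hD⟩ := exists_varSet_eq (mem_powerset.1 (mem_filter.1 hF).1)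
    refine ⟨_, yElem_add_mem_idealB hJ h0, ?_⟩
    rw [← hD] at h1 ⊢
    exact phi_yElem_add hJ h0 h1
  have h : peakIdeal (n + 2) ≤ (idealB n).map (phi (n + 2)).toLinearMap := by
    conv_lhs => rw [peakIdeal, classSpan]
    rw [Submodule.span_le]
    rintro _ ⟨⟨F, hF⟩, rfl⟩
    exact key F hF
  rintro ⟨x, hx⟩
  obtain ⟨y, hy, hyx⟩ := h hx
  exact ⟨⟨y, hy⟩, Subtype.ext hyx⟩

theorem coe_phiIdeal (x : idealB n) :
    (phiIdeal n x : MonoidAlgebra ℚ (Equiv.Perm (Fin (n + 2)))) = phi (n + 2) x := rfl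

theorem phiDescent_inclusion (n : ℕ) :
    phiDescent (n + 2) ∘ₗ Submodule.inclusion (idealB_le n) =
      Submodule.inclusion (peakIdeal_le (n + 2)) ∘ₗ phiIdeal n := by
  refine LinearMap.ext fun x => Subtype.ext ?_
  rw [LinearMap.comp_apply, LinearMap.comp_apply, coe_phiDescent, Submodule.coe_inclusion,
    Submodule.coe_inclusion, coe_phiIdeal]

theorem isIdealOf_idealB (n : ℕ) : IsIdealOf (idealB n) (descentB (n + 2)) :=
  isIdealOf_ker (isAlgMorphism_betaSq n)

theorem isIdealOf_peakIdeal (n : ℕ) : IsIdealOf (peakIdeal (n + 2)) (peakAlg (n + 2)) := by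
  rw [← map_ker_piMap]
  exact isIdealOf_ker (isAlgMorphism_piMap n)

theorem exact_inclusion {M N : Type*} [AddCommGroup M] [Module ℚ M] [AddCommGroup N] [Module ℚ N]
    {I S : Submodule ℚ M} (h : I ≤ S) (f : S →ₗ[ℚ] N) (hf : ∀ x, f x = 0 ↔ (x : M) ∈ I) :
    Function.Exact (Submodule.inclusion h) f := by
  intro x
  rw [hf]
  constructor
  · exact fun hx => ⟨⟨x, hx⟩, rfl⟩
  · rintro ⟨y, rfl⟩
    exact y.2

theorem exact_betaSq (n : ℕ) :
    Function.Exact (Submodule.inclusion (idealB_le n)) (betaSq n) :=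
  exact_inclusion _ _ fun x => (mem_idealB_iff x).symm

theorem exact_piMap (n : ℕ) :
    Function.Exact (Submodule.inclusion (peakIdeal_le (n + 2))) (piMap n) :=
  exact_inclusion _ _ piMap_eq_zero_iff

end Kernels

end PeakB

end

theorem mainTheorem4 (n : ℕ) :
    -- the objects are algebras and ideals, the horizontal maps are morphisms of algebras
    PeakB.IsAlgMorphism (PeakB.betaSq n) ∧
    PeakB.IsAlgMorphism (PeakB.piMap n) ∧
    PeakB.IsIdealOf (PeakB.idealB n) (PeakB.descentB (n + 2)) ∧
    PeakB.IsIdealOf (PeakB.peakIdeal (n + 2)) (PeakB.peakAlg (n + 2)) ∧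
    -- the first row is exact
    (Function.Injective (Submodule.inclusion (PeakB.idealB_le n)) ∧
      Function.Exact (Submodule.inclusion (PeakB.idealB_le n)) (PeakB.betaSq n) ∧
      Function.Surjective (PeakB.betaSq n)) ∧
    -- the second row is exact
    (Function.Injective (Submodule.inclusion (PeakB.peakIdeal_le (n + 2))) ∧
      Function.Exact (Submodule.inclusion (PeakB.peakIdeal_le (n + 2))) (PeakB.piMap n) ∧
      Function.Surjective (PeakB.piMap n)) ∧
    -- the vertical maps are the restrictions of `φ`
    ∃ (φ₁ : PeakB.idealB n →ₗ[ℚ] PeakB.peakIdeal (n + 2))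
      (φ₂ : PeakB.descentB (n + 2) →ₗ[ℚ] PeakB.peakAlg (n + 2))
      (φ₃ : PeakB.descentB n →ₗ[ℚ] PeakB.peakAlg n),
      (∀ x, (φ₁ x : MonoidAlgebra ℚ (Equiv.Perm (Fin (n + 2)))) = PeakB.phi (n + 2) x) ∧
      (∀ x, (φ₂ x : MonoidAlgebra ℚ (Equiv.Perm (Fin (n + 2)))) = PeakB.phi (n + 2) x) ∧
      (∀ x, (φ₃ x : MonoidAlgebra ℚ (Equiv.Perm (Fin n))) = PeakB.phi n x) ∧
      PeakB.IsAlgMorphism φ₂ ∧ PeakB.IsAlgMorphism φ₃ ∧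
      Function.Surjective φ₁ ∧ Function.Surjective φ₂ ∧ Function.Surjective φ₃ ∧
      -- the two squares commute
      φ₂ ∘ₗ Submodule.inclusion (PeakB.idealB_le n) =
        Submodule.inclusion (PeakB.peakIdeal_le (n + 2)) ∘ₗ φ₁ ∧
      φ₃ ∘ₗ PeakB.betaSq n = PeakB.piMap n ∘ₗ φ₂ := by
  exact ⟨PeakB.isAlgMorphism_betaSq n, PeakB.isAlgMorphism_piMap n,
    PeakB.isIdealOf_idealB n, PeakB.isIdealOf_peakIdeal n,
    ⟨Submodule.inclusion_injective _, PeakB.exact_betaSq n, PeakB.betaSq_surjective n⟩,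
    ⟨Submodule.inclusion_injective _, PeakB.exact_piMap n, PeakB.piMap_surjective n⟩,
    PeakB.phiIdeal n, PeakB.phiDescent (n + 2), PeakB.phiDescent n, PeakB.coe_phiIdeal,
    PeakB.coe_phiDescent, PeakB.coe_phiDescent, PeakB.isAlgMorphism_phiDescent _,
    PeakB.isAlgMorphism_phiDescent _, PeakB.phiIdeal_surjective n,
    PeakB.phiDescent_surjective _, PeakB.phiDescent_surjective _,
    PeakB.phiDescent_inclusion n, PeakB.phiDescent_betaSq n⟩
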